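/- Let $q>0$, let $\lambda\in C([0,\infty))$ satisfy $\sup_{t\ge0}\lambda(t)<\infty$, let $c_0>0$ satisfy $c_0>\sup_{t\ge0}\lambda(t)$, and put $\underline c:=\inf_{t\ge0}(c_0-\lambda(t))>0$. Let $D:=\{(x,z):0\le z\le x\le1\}$. Let $m\in C^2(D)$ be the solution of $$m_{xx}-m_{zz}=c_0m\ \text{ on }D,\qquad \tfrac{d}{dx}m(x,x)=-\tfrac12c_0,\qquad m(1,z)=0,$$ and let $n\in C^2(D)$ be the solution of the same problem with $n_{xx}-n_{zz}=-c_0n$ in place of the first equation. Let the observer gains $p_0\in\mathbb R$ and $p\in C([0,1])$ satisfy $p_0>\frac{c_0}2-q$ and $$p(x)=-m_z(x,0)+(q+p_0)\,m(x,0)+\int_0^x m(x,z)p(z)\,dz,\qquad x\in[0,1].$$ For disturbances $f\in C([0,1]\times[0,\infty))$ and $d_m,d_0,d_1\in C([0,\infty))$ consider classical solutions $\tilde u\in C^{2,1}((0,1)\times(0,\infty))\cap C([0,1]\times[0,\infty))$ of the state estimation error system $$\begin{aligned}\tilde u_t(x,t)&=\tilde u_{xx}(x,t)+\lambda(t)\tilde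 u(x,t)+f(x,t)-p(x)d_m(t)-p(x)\tilde u(0,t),&&(x,t)\in(0,1)\times(0,\infty),\\ \tilde u_x(0,t)&=d_0(t)+p_0d_m(t)+(q+p_0)\tilde u(0,t),&&t>0,\\ \tilde u(1,t)&=d_1(t),&&t>0,\\ \tilde u(x,0)&=\tilde u_0(x),&&x\in(0,1).\end{aligned}$$ Then this system is input-to-state stable in the $L^\infty$-norm with respect to $f,d_m,d_0,d_1$: there are $\beta\in\mathcal{KL}$ and $\gamma_m,\gamma_0,\gamma_1,\gamma_f\in\mathcal K$ such that, for all such disturbances and solutions and all $T>0$, $$\|\tilde u(\cdot,T)\|_{L^\infty(0,1)}\le\beta\big(\|\tilde u_0\|_{L^\infty(0,1)},T\big)+\gamma_m\big(\|d_m\|_{L^\infty(0,T)}\big)+\gamma_0\big(\|d_0\|_{L^\infty(0,T)}\big)+\gamma_1\big(\|d_1\|_{L^\infty(0,T)}\big)+\gamma_f\big(\|f\|_{L^\infty((0,T);L^\infty(0,1))}\big).$$ More precisely, for every $\sigma\in(0,\underline c)$, all such disturbances and solutions, and all $T>0$, $$\|\tilde u(\cdot,T)\|_{L^\infty(0,1)}\le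 c_3\Big(e^{-\sigma T}\|\tilde u_0\|_{L^\infty(0,1)}+\|d_m\|_{L^\infty(0,T)}+\|d_0\|_{L^\infty(0,T)}+\|d_1\|_{L^\infty(0,T)}+\|f\|_{L^\infty((0,T);L^\infty(0,1))}\Big),$$ where $c_3>0$ depends only on $\underline c$, $\sigma$, $p_0$, $q$, $\max_{[0,1]}|p|$, $\max_D|m|$ and $\max_D|n|$. -/

import Mathlib

open Set MeasureTheory Filter Topology
open scoped ENNReal NNReal

noncomputable section

namespace BacksteppingObserver

/-! ### Norms and comparison functions -/

/-- The `L^∞(a, b)`-norm (essential supremum of `|v|` over `(a, b)`), as an extended real. -/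
def linftyNorm (v : ℝ → ℝ) (a b : ℝ) : ℝ≥0∞ :=
  eLpNorm v ⊤ (volume.restrict (Ioo a b))

/-- The norm of `L^∞((0, T); L^∞(0, 1))`, as an extended real. -/
def linftyLinftyNorm (f : ℝ → ℝ → ℝ) (T : ℝ) : ℝ≥0∞ :=
  essSup (fun t => linftyNorm (fun x => f x t) 0 1) (volume.restrict (Ioo 0 T))

/-- Comparison functions of class `𝒦`. -/
def ClassK (γ : ℝ≥0 → ℝ≥0) : Prop :=
  γ 0 = 0 ∧ Continuous γ ∧ StrictMono γ

/-- Comparison functions of class `ℒ`. -/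
def ClassL (γ : ℝ≥0 → ℝ≥0) : Prop :=
  Continuous γ ∧ StrictAnti γ ∧ Tendsto γ atTop (𝓝 0)

/-- Comparison functions of class `𝒦ℒ`. -/
def ClassKL (β : ℝ≥0 → ℝ≥0 → ℝ≥0) : Prop :=
  Continuous (Function.uncurry β) ∧ (∀ t, ClassK (fun s => β s t)) ∧
    ∀ s, 0 < s → ClassL (fun t => β s t)

/-! ### Kernel functions on the closed triangle -/

/-- The triangle `D = {(x, z) | 0 ≤ z ≤ x ≤ 1}`. -/
def triangle : Set (ℝ × ℝ) := {y | 0 ≤ y.2 ∧ y.2 ≤ y.1 ∧ y.1 ≤ 1}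

/-- Partial derivative in the first variable of a function on `D`
(one-sided at the boundary of `D`). -/
def kx (k : ℝ × ℝ → ℝ) (y : ℝ × ℝ) : ℝ := fderivWithin ℝ k triangle y (1, 0)

/-- Partial derivative in the second variable of a function on `D`
(one-sided at the boundary of `D`). -/
def kz (k : ℝ × ℝ → ℝ) (y : ℝ × ℝ) : ℝ := fderivWithin ℝ k triangle y (0, 1)

/-- `k ∈ C²(D)` solves `k_xx - k_zz = a k` on `D`, with `(d/dx) k(x, x) = -c₀ / 2` and
`k(1, z) = 0`. The observer kernel `m` is the case `a = c₀`, the kernel `n` of the inverse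
transformation is the case `a = -c₀`. -/
structure IsKernel (a c₀ : ℝ) (k : ℝ × ℝ → ℝ) : Prop where
  contDiffOn : ContDiffOn ℝ 2 k triangle
  pde : ∀ y ∈ triangle, kx (kx k) y - kz (kz k) y = a * k y
  diagonal : ∀ x ∈ Icc (0 : ℝ) 1, kx k (x, x) + kz k (x, x) = -(1 / 2) * c₀
  right_edge : ∀ z ∈ Icc (0 : ℝ) 1, k (1, z) = 0

/-- `max_{(x, z) ∈ D} |k(x, z)|`. -/
def kernelMax (k : ℝ × ℝ → ℝ) : ℝ := sSup ((fun y => |k y|) '' triangle)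

/-- `max_{x ∈ [0, 1]} |p(x)|`. -/
def gainMax (p : ℝ → ℝ) : ℝ := sSup ((fun x => |p x|) '' Icc (0 : ℝ) 1)

/-- `inf_{t ≥ 0} (c₀ - lam(t))`. -/
def cInf (lam : ℝ → ℝ) (c₀ : ℝ) : ℝ := sInf ((fun t => c₀ - lam t) '' Ici (0 : ℝ))

/-- The standing assumptions on the plant coefficients `q`, `lam`, the choice of `c₀`,
the kernel `m`, and the observer gains `p₀`, `p`. -/
structure IsDesign (q : ℝ) (lam : ℝ → ℝ) (c₀ : ℝ) (m : ℝ × ℝ → ℝ) (p₀ : ℝ) (p : ℝ → ℝ) :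
    Prop where
  q_pos : 0 < q
  lam_cont : ContinuousOn lam (Ici 0)
  lam_bdd : BddAbove (lam '' Ici (0 : ℝ))
  c₀_pos : 0 < c₀
  lam_lt : sSup (lam '' Ici (0 : ℝ)) < c₀
  kernel : IsKernel c₀ c₀ m
  p₀_gt : c₀ / 2 - q < p₀
  p_cont : ContinuousOn p (Icc 0 1)
  p_eq : ∀ x ∈ Icc (0 : ℝ) 1,
    p x = -kz m (x, 0) + (q + p₀) * m (x, 0) + ∫ z in (0 : ℝ)..x, m (x, z) * p z

/-! ### The state estimation error system

Functions of space and time are written `v x t`. -/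

/-- Partial derivative in space. -/
def dX (v : ℝ → ℝ → ℝ) (x t : ℝ) : ℝ := deriv (fun y => v y t) x

/-- Partial derivative in time. -/
def dT (v : ℝ → ℝ → ℝ) (x t : ℝ) : ℝ := deriv (fun s => v x s) t

/-- `v ∈ C^{2,1}((0, 1) × (0, ∞))`: the derivatives `v_x`, `v_xx`, `v_t` exist, and they and
`v` are continuous there. -/
structure IsC21 (v : ℝ → ℝ → ℝ) : Prop where
  diff_x : ∀ x ∈ Ioo (0 : ℝ) 1, ∀ t ∈ Ioi (0 : ℝ), DifferentiableAt ℝ (fun y => v y t) x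
  diff_xx : ∀ x ∈ Ioo (0 : ℝ) 1, ∀ t ∈ Ioi (0 : ℝ), DifferentiableAt ℝ (fun y => dX v y t) x
  diff_t : ∀ x ∈ Ioo (0 : ℝ) 1, ∀ t ∈ Ioi (0 : ℝ), DifferentiableAt ℝ (fun s => v x s) t
  cont : ContinuousOn (Function.uncurry v) (Ioo 0 1 ×ˢ Ioi 0)
  cont_x : ContinuousOn (Function.uncurry (dX v)) (Ioo 0 1 ×ˢ Ioi 0)
  cont_xx : ContinuousOn (Function.uncurry (dX (dX v))) (Ioo 0 1 ×ˢ Ioi 0)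
  cont_t : ContinuousOn (Function.uncurry (dT v)) (Ioo 0 1 ×ˢ Ioi 0)

/-- The disturbances are continuous: `f ∈ C([0, 1] × [0, ∞))`, `d_m, d₀, d₁ ∈ C([0, ∞))`. -/
structure IsDisturbance (f : ℝ → ℝ → ℝ) (dm d₀ d₁ : ℝ → ℝ) : Prop where
  f_cont : ContinuousOn (Function.uncurry f) (Icc 0 1 ×ˢ Ici 0)
  dm_cont : ContinuousOn dm (Ici 0)
  d₀_cont : ContinuousOn d₀ (Ici 0)
  d₁_cont : ContinuousOn d₁ (Ici 0)

/-- `u ∈ C^{2,1}((0, 1) × (0, ∞)) ∩ C([0, 1] × [0, ∞))` is a classical solution of the state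
estimation error system with disturbances `f, d_m, d₀, d₁` and initial datum `u₀`.
The boundary derivative `u_x(0, t)` is the one-sided derivative. -/
structure IsErrorSolution (q : ℝ) (lam : ℝ → ℝ) (p₀ : ℝ) (p : ℝ → ℝ)
    (f : ℝ → ℝ → ℝ) (dm d₀ d₁ u₀ : ℝ → ℝ) (u : ℝ → ℝ → ℝ) : Prop where
  c21 : IsC21 u
  cont : ContinuousOn (Function.uncurry u) (Icc 0 1 ×ˢ Ici 0)
  pde : ∀ x ∈ Ioo (0 : ℝ) 1, ∀ t ∈ Ioi (0 : ℝ),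
    dT u x t = dX (dX u) x t + lam t * u x t + (f x t - p x * dm t) - p x * u 0 t
  left_bc : ∀ t ∈ Ioi (0 : ℝ),
    HasDerivWithinAt (fun x => u x t) ((d₀ t + p₀ * dm t) + (q + p₀) * u 0 t) (Icc 0 1) 0
  right_bc : ∀ t ∈ Ioi (0 : ℝ), u 1 t = d₁ t
  init : ∀ x ∈ Ioo (0 : ℝ) 1, u x 0 = u₀ x

/-- The state estimation error system is input-to-state stable in the `L^∞`-norm with respect
to `f, d_m, d₀, d₁`. -/
def IsISS (q : ℝ) (lam : ℝ → ℝ) (p₀ : ℝ) (p : ℝ → ℝ) : Prop :=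
  ∃ (β : ℝ≥0 → ℝ≥0 → ℝ≥0) (γf γm γ₀ γ₁ : ℝ≥0 → ℝ≥0),
    ClassKL β ∧ ClassK γf ∧ ClassK γm ∧ ClassK γ₀ ∧ ClassK γ₁ ∧
    ∀ (f : ℝ → ℝ → ℝ) (dm d₀ d₁ u₀ : ℝ → ℝ) (u : ℝ → ℝ → ℝ),
      IsDisturbance f dm d₀ d₁ → IsErrorSolution q lam p₀ p f dm d₀ d₁ u₀ u →
      ∀ T : ℝ, 0 < T →
        linftyNorm (fun x => u x T) 0 1 ≤
          ((β (linftyNorm u₀ 0 1).toNNReal T.toNNReal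
            + γm (linftyNorm dm 0 T).toNNReal
            + γ₀ (linftyNorm d₀ 0 T).toNNReal
            + γ₁ (linftyNorm d₁ 0 T).toNNReal
            + γf (linftyLinftyNorm f T).toNNReal : ℝ≥0) : ℝ≥0∞)

end BacksteppingObserver

end

noncomputable section

namespace BacksteppingObserver

/-! ### A weak maximum principle with pointwise flux conditions -/

/-! For a function smooth up to the boundary, the Volterra transformation `w = backstep m v` turns
the error system into a heat equation with damping `c₀ - lam t ≥ cInf lam c₀ > 0`. The kernel
equation and the diagonal condition produce the damping. The equation for `p` removes the feedback
through `v 0 t`. The value `m (0, 0) = c₀ / 2` turns the Robin coefficient into `q + p₀ - c₀ / 2 >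
0`. Since `m (1, z) = 0`, the Dirichlet datum is unchanged. A barrier and the maximum principle then
bound `w` in the sup norm (`abs_le_of_damped`). A weighted Gronwall argument (`abs_le_of_volterra`)
returns from `w` to `v` at the cost of a factor `exp (kernelMax m)`. Together these give
`IsDesign.regular_estimate`.

A classical solution `u` cannot be transformed directly: its spatial derivatives need not be
continuous up to `x = 0`, so the integrations by parts are not available. Instead, all terms of the
system except `u_t - u_xx` are frozen as known continuous data of a heat equation solved by `u`.
Stone–Weierstrass with explicit cosine solutions gives a smooth `v` whose heat data are within `ε`
of these (`exists_regular_near`). The maximum principle needs only pointwise one-sided fluxes, so it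
applies to `u - v` and gives `|u - v| ≤ ε * (3 + 2 * T)`. Hence `v` solves the error system up to
`O(ε)`, the estimate for smooth functions applies to it, and `ε → 0` gives the bound for `u`. -/

/-- A positive second derivative would make the critical point a local minimum as well, so `f` would
be locally constant and the second derivative zero. -/
theorem second_deriv_nonpos_of_isLocalMax {f f' : ℝ → ℝ} {a c : ℝ}
    (hf : ∀ᶠ x in 𝓝 a, HasDerivAt f (f' x) x) (hf' : HasDerivAt f' c a)
    (hmax : IsLocalMax f a) : c ≤ 0 := by
  by_contra! hc
  have hd : deriv f =ᶠ[𝓝 a] f' := hf.mono fun x hx => hx.deriv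
  have h2 : deriv (deriv f) a = c := by rw [hd.deriv_eq, hf'.deriv]
  have hmin : IsLocalMin f a :=
    isLocalMin_of_deriv_deriv_pos (by rw [h2]; exact hc) hmax.deriv_eq_zero
      hf.self_of_nhds.continuousAt
  have hconst : f =ᶠ[𝓝 a] fun _ => f a := by
    filter_upwards [hmax, hmin] with x h1 h2 using le_antisymm h1 h2
  have h3 : deriv f =ᶠ[𝓝 a] fun _ => 0 := by
    simpa using hconst.deriv
  rw [h3.deriv_eq] at h2
  simp at h2
  exact hc.ne h2

/-- One-sided because the maximum over the strip may sit at the final time `T`. -/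
theorem deriv_nonneg_of_le_left {f : ℝ → ℝ} {a c : ℝ} (hf : HasDerivAt f c a)
    (hle : ∀ᶠ s in 𝓝[<] a, f s ≤ f a) : 0 ≤ c := by
  have h := (hasDerivAt_iff_tendsto_slope.1 hf).mono_left
    (nhdsWithin_mono a (show Iio a ⊆ {a}ᶜ from fun x hx => ne_of_lt hx))
  refine ge_of_tendsto h ?_
  filter_upwards [hle, self_mem_nhdsWithin] with s hs hsa
  rw [slope_def_field]
  exact div_nonneg_of_nonpos (by linarith) (by have : s < a := hsa; linarith)

theorem derivWithin_nonpos_of_le_right {f : ℝ → ℝ} {c : ℝ}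
    (hf : HasDerivWithinAt f c (Icc 0 1) 0) (hle : ∀ x ∈ Icc (0 : ℝ) 1, f x ≤ f 0) : c ≤ 0 := by
  have h := (hasDerivWithinAt_iff_tendsto_slope' (by simp : (0 : ℝ) ∉ Ioc (0 : ℝ) 1)).1
    (hf.mono Ioc_subset_Icc_self)
  have : (𝓝[Ioc (0 : ℝ) 1] 0).NeBot := by
    rw [nhdsWithin_Ioc_eq_nhdsGT one_pos]; infer_instance
  refine le_of_tendsto h ?_
  filter_upwards [self_mem_nhdsWithin] with s hs
  rw [slope_def_field]
  exact div_nonpos_of_nonpos_of_nonneg (by linarith [hle s ⟨hs.1.le, hs.2⟩]) (by linarith [hs.1])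

/-- A positive maximum over the closed rectangle can lie neither on the initial line nor at `x = 1`.
At `x = 0` it contradicts the positive slope, and inside it forces `yxx ≤ 0 ≤ yt`. No continuity of
derivatives is used. The conditions are asked only where `y > 0`, which is where damping and Robin
terms have a favourable sign. -/
theorem nonpos_of_strict_subsolution {T : ℝ} {y yx yxx yt : ℝ → ℝ → ℝ}
    (hc : ContinuousOn (Function.uncurry y) (Icc 0 1 ×ˢ Icc 0 T))
    (ht : ∀ x ∈ Ioo (0 : ℝ) 1, ∀ t ∈ Ioc 0 T, HasDerivAt (fun s => y x s) (yt x t) t)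
    (hx : ∀ x ∈ Ioo (0 : ℝ) 1, ∀ t ∈ Ioc 0 T, HasDerivAt (fun z => y z t) (yx x t) x)
    (hxx : ∀ x ∈ Ioo (0 : ℝ) 1, ∀ t ∈ Ioc 0 T, HasDerivAt (fun z => yx z t) (yxx x t) x)
    (hpde : ∀ x ∈ Ioo (0 : ℝ) 1, ∀ t ∈ Ioc 0 T, 0 < y x t → yt x t < yxx x t)
    (hleft : ∀ t ∈ Ioc 0 T, 0 < y 0 t →
      ∃ g > 0, HasDerivWithinAt (fun x => y x t) g (Icc 0 1) 0)
    (hright : ∀ t ∈ Ioc 0 T, y 1 t ≤ 0) (hinit : ∀ x ∈ Icc (0 : ℝ) 1, y x 0 ≤ 0) :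
    ∀ x ∈ Icc (0 : ℝ) 1, ∀ t ∈ Icc 0 T, y x t ≤ 0 := by
  intro x₀ hx₀ t₀ ht₀
  by_contra! hpos
  obtain ⟨⟨x, t⟩, ⟨hxm, htm⟩, hmax⟩ :=
    (isCompact_Icc.prod isCompact_Icc).exists_isMaxOn ⟨(x₀, t₀), hx₀, ht₀⟩ hc
  simp only at hxm htm
  have hle : ∀ z ∈ Icc (0 : ℝ) 1, ∀ s ∈ Icc 0 T, y z s ≤ y x t := fun z hz s hs =>
    hmax (show (z, s) ∈ Icc (0 : ℝ) 1 ×ˢ Icc 0 T from ⟨hz, hs⟩)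
  have hp : 0 < y x t := hpos.trans_le (hle x₀ hx₀ t₀ ht₀)
  have ht0 : 0 < t := by
    rcases htm.1.eq_or_lt with h | h
    · subst h; exact absurd (hinit x hxm) (not_le.2 hp)
    · exact h
  have htI : t ∈ Ioc 0 T := ⟨ht0, htm.2⟩
  rcases hxm.1.eq_or_lt with h | hx0
  · subst h
    obtain ⟨g, hg, hd⟩ := hleft t htI hp
    exact absurd (derivWithin_nonpos_of_le_right hd fun z hz => hle z hz t htm) (not_le.2 hg)
  rcases hxm.2.eq_or_lt with h | hx1
  · subst h; exact absurd (hright t htI) (not_le.2 hp)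
  have hxI : x ∈ Ioo (0 : ℝ) 1 := ⟨hx0, hx1⟩
  have hnx : Ioo (0 : ℝ) 1 ∈ 𝓝 x := Ioo_mem_nhds hx0 hx1
  have h1 : 0 ≤ yt x t := by
    refine deriv_nonneg_of_le_left (ht x hxI t htI) ?_
    filter_upwards [Ioo_mem_nhdsLT ht0] with s hs using hle x hxm s ⟨hs.1.le, hs.2.le.trans htm.2⟩
  have h2 : yxx x t ≤ 0 := by
    refine second_deriv_nonpos_of_isLocalMax (f := fun z => y z t) (f' := fun z => yx z t)
      (a := x) ?_ (hxx x hxI t htI) ?_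
    · filter_upwards [hnx] with z hz using hx z hz t htI
    · filter_upwards [hnx] with z hz using hle z (Ioo_subset_Icc_self hz) t htm
  linarith [hpde x hxI t htI hp]

/-- Smooth functions of `(x, t)` together with the derivatives entering the heat equation. -/
structure IsRegular (v vx vxx vt : ℝ → ℝ → ℝ) : Prop where
  cont : Continuous (Function.uncurry v)
  cont_x : Continuous (Function.uncurry vx)
  cont_xx : Continuous (Function.uncurry vxx)
  cont_t : Continuous (Function.uncurry vt)
  deriv_x : ∀ x t, HasDerivAt (fun z => v z t) (vx x t) x
  deriv_xx : ∀ x t, HasDerivAt (fun z => vx z t) (vxx x t) x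
  deriv_t : ∀ x t, HasDerivAt (fun s => v x s) (vt x t) t

namespace IsRegular

variable {v vx vxx vt w wx wxx wt : ℝ → ℝ → ℝ}

theorem add (hv : IsRegular v vx vxx vt) (hw : IsRegular w wx wxx wt) :
    IsRegular (fun x t => v x t + w x t) (fun x t => vx x t + wx x t)
      (fun x t => vxx x t + wxx x t) (fun x t => vt x t + wt x t) where
  cont := hv.cont.add hw.cont
  cont_x := hv.cont_x.add hw.cont_x
  cont_xx := hv.cont_xx.add hw.cont_xx
  cont_t := hv.cont_t.add hw.cont_t
  deriv_x x t := (hv.deriv_x x t).add (hw.deriv_x x t)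
  deriv_xx x t := (hv.deriv_xx x t).add (hw.deriv_xx x t)
  deriv_t x t := (hv.deriv_t x t).add (hw.deriv_t x t)

theorem const_mul (c : ℝ) (hv : IsRegular v vx vxx vt) :
    IsRegular (fun x t => c * v x t) (fun x t => c * vx x t)
      (fun x t => c * vxx x t) (fun x t => c * vt x t) where
  cont := continuous_const.mul hv.cont
  cont_x := continuous_const.mul hv.cont_x
  cont_xx := continuous_const.mul hv.cont_xx
  cont_t := continuous_const.mul hv.cont_t
  deriv_x x t := (hv.deriv_x x t).const_mul c
  deriv_xx x t := (hv.deriv_xx x t).const_mul c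
  deriv_t x t := (hv.deriv_t x t).const_mul c

theorem reflect (a : ℝ) (hv : IsRegular v vx vxx vt) :
    IsRegular (fun x t => v (a - x) t) (fun x t => -vx (a - x) t)
      (fun x t => vxx (a - x) t) (fun x t => vt (a - x) t) where
  cont := hv.cont.comp ((continuous_const.sub continuous_fst).prodMk continuous_snd)
  cont_x := (hv.cont_x.comp ((continuous_const.sub continuous_fst).prodMk continuous_snd)).neg
  cont_xx := hv.cont_xx.comp ((continuous_const.sub continuous_fst).prodMk continuous_snd)
  cont_t := hv.cont_t.comp ((continuous_const.sub continuous_fst).prodMk continuous_snd)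
  deriv_x x t := by
    exact ((hv.deriv_x (a - x) t).comp x ((hasDerivAt_id x).const_sub a)).congr_deriv (by ring)
  deriv_xx x t := by
    exact ((hv.deriv_xx (a - x) t).comp x ((hasDerivAt_id x).const_sub a)).neg.congr_deriv
      (by ring)
  deriv_t x t := hv.deriv_t (a - x) t

theorem of_mul {g g' g'' h h' : ℝ → ℝ} (hg : ∀ x, HasDerivAt g (g' x) x)
    (hg' : ∀ x, HasDerivAt g' (g'' x) x) (hg'' : Continuous g'')
    (hh : ∀ t, HasDerivAt h (h' t) t) (hh' : Continuous h') :
    IsRegular (fun x t => g x * h t) (fun x t => g' x * h t)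
      (fun x t => g'' x * h t) (fun x t => g x * h' t) := by
  have cg : Continuous g := continuous_iff_continuousAt.2 fun x => (hg x).continuousAt
  have cg' : Continuous g' := continuous_iff_continuousAt.2 fun x => (hg' x).continuousAt
  have ch : Continuous h := continuous_iff_continuousAt.2 fun x => (hh x).continuousAt
  exact
  { cont := (cg.comp continuous_fst).mul (ch.comp continuous_snd)
    cont_x := (cg'.comp continuous_fst).mul (ch.comp continuous_snd)
    cont_xx := (hg''.comp continuous_fst).mul (ch.comp continuous_snd)
    cont_t := (cg.comp continuous_fst).mul (hh'.comp continuous_snd)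
    deriv_x := fun x t => (hg x).mul_const (h t)
    deriv_xx := fun x t => (hg' x).mul_const (h t)
    deriv_t := fun x t => (hh t).const_mul (g x) }

end IsRegular

/-- Functions which are regular in the interior of the strip `(0, 1) × (0, T]` only. -/
structure IsInteriorRegular (T : ℝ) (v vx vxx vt : ℝ → ℝ → ℝ) : Prop where
  cont : ContinuousOn (Function.uncurry v) (Icc 0 1 ×ˢ Icc 0 T)
  deriv_x : ∀ x ∈ Ioo (0 : ℝ) 1, ∀ t ∈ Ioc 0 T, HasDerivAt (fun z => v z t) (vx x t) x
  deriv_xx : ∀ x ∈ Ioo (0 : ℝ) 1, ∀ t ∈ Ioc 0 T, HasDerivAt (fun z => vx z t) (vxx x t) x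
  deriv_t : ∀ x ∈ Ioo (0 : ℝ) 1, ∀ t ∈ Ioc 0 T, HasDerivAt (fun s => v x s) (vt x t) t

theorem IsRegular.isInteriorRegular {v vx vxx vt : ℝ → ℝ → ℝ} (hv : IsRegular v vx vxx vt)
    (T : ℝ) : IsInteriorRegular T v vx vxx vt :=
  ⟨hv.cont.continuousOn, fun x _ t _ => hv.deriv_x x t, fun x _ t _ => hv.deriv_xx x t,
    fun x _ t _ => hv.deriv_t x t⟩

namespace IsInteriorRegular

variable {T : ℝ} {v vx vxx vt w wx wxx wt : ℝ → ℝ → ℝ}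

theorem sub (hv : IsInteriorRegular T v vx vxx vt) (hw : IsInteriorRegular T w wx wxx wt) :
    IsInteriorRegular T (fun x t => v x t - w x t) (fun x t => vx x t - wx x t)
      (fun x t => vxx x t - wxx x t) (fun x t => vt x t - wt x t) where
  cont := hv.cont.sub hw.cont
  deriv_x x hx t ht := (hv.deriv_x x hx t ht).sub (hw.deriv_x x hx t ht)
  deriv_xx x hx t ht := (hv.deriv_xx x hx t ht).sub (hw.deriv_xx x hx t ht)
  deriv_t x hx t ht := (hv.deriv_t x hx t ht).sub (hw.deriv_t x hx t ht)

theorem neg (hv : IsInteriorRegular T v vx vxx vt) :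
    IsInteriorRegular T (fun x t => -v x t) (fun x t => -vx x t)
      (fun x t => -vxx x t) (fun x t => -vt x t) where
  cont := hv.cont.neg
  deriv_x x hx t ht := (hv.deriv_x x hx t ht).neg
  deriv_xx x hx t ht := (hv.deriv_xx x hx t ht).neg
  deriv_t x hx t ht := (hv.deriv_t x hx t ht).neg

theorem nonpos (hv : IsInteriorRegular T v vx vxx vt)
    (hpde : ∀ x ∈ Ioo (0 : ℝ) 1, ∀ t ∈ Ioc 0 T, 0 < v x t → vt x t < vxx x t)
    (hleft : ∀ t ∈ Ioc 0 T, 0 < v 0 t →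
      ∃ g > 0, HasDerivWithinAt (fun x => v x t) g (Icc 0 1) 0)
    (hright : ∀ t ∈ Ioc 0 T, v 1 t ≤ 0) (hinit : ∀ x ∈ Icc (0 : ℝ) 1, v x 0 ≤ 0) :
    ∀ x ∈ Icc (0 : ℝ) 1, ∀ t ∈ Icc 0 T, v x t ≤ 0 :=
  nonpos_of_strict_subsolution hv.cont hv.deriv_t hv.deriv_x hv.deriv_xx hpde hleft hright hinit

/-- One-sided estimate for the heat equation with small data. -/
theorem le_of_heat (hv : IsInteriorRegular T v vx vxx vt) {ε : ℝ} (hε : 0 < ε)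
    (hpde : ∀ x ∈ Ioo (0 : ℝ) 1, ∀ t ∈ Ioc 0 T, |vt x t - vxx x t| ≤ ε)
    (hleft : ∀ t ∈ Ioc 0 T, ∃ g, |g| ≤ ε ∧ HasDerivWithinAt (fun x => v x t) g (Icc 0 1) 0)
    (hright : ∀ t ∈ Ioc 0 T, |v 1 t| ≤ ε) (hinit : ∀ x ∈ Icc (0 : ℝ) 1, |v x 0| ≤ ε) :
    ∀ x ∈ Icc (0 : ℝ) 1, ∀ t ∈ Icc 0 T, v x t ≤ ε * (3 + 2 * T) := by
  -- Barrier `ε * (1 + 2 * (1 - x) + 2 * t)`. Its heat residual `2ε` and slope `-2ε` strictly beat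
  -- the defects `ε`, and it is at least `ε` on the initial line and at `x = 1`.
  have hZ : IsRegular (fun x t => ε * (1 + 2 * (1 - x)) * 1 + 1 * (2 * ε * t))
      (fun x t => ε * (2 * -1) * 1 + 0 * (2 * ε * t)) (fun x t => 0 * 1 + 0 * (2 * ε * t))
      (fun x t => ε * (1 + 2 * (1 - x)) * 0 + 1 * (2 * ε * 1)) := by
    refine (IsRegular.of_mul (fun x => ?_) (fun x => hasDerivAt_const _ _) continuous_const
      (fun t => hasDerivAt_const _ _) continuous_const).add
      (IsRegular.of_mul (fun x => hasDerivAt_const _ _) (fun x => hasDerivAt_const _ _)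
      continuous_const (fun t => ?_) continuous_const)
    · exact ((((hasDerivAt_id x).const_sub 1).const_mul 2).const_add 1).const_mul ε
    · exact (hasDerivAt_id t).const_mul (2 * ε)
  have hy := hv.sub (hZ.isInteriorRegular T)
  have key := hy.nonpos ?_ ?_ ?_ ?_
  · intro x hx t ht
    have h1 := key x hx t ht
    nlinarith [mul_nonneg hε.le hx.1, mul_le_mul_of_nonneg_left ht.2 hε.le]
  · intro x hx t ht _
    have := (abs_le.1 (hpde x hx t ht)).2
    linarith
  · intro t ht _
    obtain ⟨g, hg, hd⟩ := hleft t ht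
    exact ⟨_, by linarith [(abs_le.1 hg).1], hd.sub (hZ.deriv_x 0 t).hasDerivWithinAt⟩
  · intro t ht
    nlinarith [(abs_le.1 (hright t ht)).2, mul_nonneg hε.le ht.1.le]
  · intro x hx
    nlinarith [(abs_le.1 (hinit x hx)).2, mul_nonneg hε.le (sub_nonneg.2 hx.2)]

theorem abs_le_of_heat (hv : IsInteriorRegular T v vx vxx vt) {ε : ℝ} (hε : 0 < ε)
    (hpde : ∀ x ∈ Ioo (0 : ℝ) 1, ∀ t ∈ Ioc 0 T, |vt x t - vxx x t| ≤ ε)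
    (hleft : ∀ t ∈ Ioc 0 T, ∃ g, |g| ≤ ε ∧ HasDerivWithinAt (fun x => v x t) g (Icc 0 1) 0)
    (hright : ∀ t ∈ Ioc 0 T, |v 1 t| ≤ ε) (hinit : ∀ x ∈ Icc (0 : ℝ) 1, |v x 0| ≤ ε) :
    ∀ x ∈ Icc (0 : ℝ) 1, ∀ t ∈ Icc 0 T, |v x t| ≤ ε * (3 + 2 * T) := by
  intro x hx t ht
  refine abs_le'.2 ⟨hv.le_of_heat hε hpde hleft hright hinit x hx t ht,
    hv.neg.le_of_heat hε (fun x hx t ht => ?_) (fun t ht => ?_) (fun t ht => ?_)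
      (fun x hx => ?_) x hx t ht⟩
  · rw [← neg_sub', abs_neg]; exact hpde x hx t ht
  · obtain ⟨g, hg, hd⟩ := hleft t ht
    exact ⟨-g, by rwa [abs_neg], hd.neg⟩
  · rw [abs_neg]; exact hright t ht
  · rw [abs_neg]; exact hinit x hx

/-- One-sided decay estimate for a damped heat equation with a Robin condition at `x = 0`.
The bound does not depend on the Robin coefficient `κ > 0`. -/
theorem le_of_damped (hv : IsInteriorRegular T v vx vxx vt) {a ĝ : ℝ → ℝ} {c σ κ A R E D : ℝ}
    (hσ : σ ≤ c) (hc : 0 < c) (hκ : 0 < κ) (hA : 0 ≤ A) (hR : 0 ≤ R) (hE : 0 ≤ E) (hD : 0 ≤ D)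
    (ha : ∀ t ∈ Ioc 0 T, c ≤ a t)
    (hpde : ∀ x ∈ Ioo (0 : ℝ) 1, ∀ t ∈ Ioc 0 T, |vt x t - vxx x t + a t * v x t| ≤ R)
    (hleft : ∀ t ∈ Ioc 0 T, HasDerivWithinAt (fun x => v x t) (κ * v 0 t + ĝ t) (Icc 0 1) 0)
    (hg : ∀ t ∈ Ioc 0 T, |ĝ t| ≤ E)
    (hright : ∀ t ∈ Ioc 0 T, |v 1 t| ≤ D) (hinit : ∀ x ∈ Icc (0 : ℝ) 1, |v x 0| ≤ A) :
    ∀ x ∈ Icc (0 : ℝ) 1, ∀ t ∈ Icc 0 T, v x t ≤ Real.exp (-σ * t) * A + R / c + D + E := by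
  -- Barrier `A e^{-σt} + R / c + D + E (1 - x)`: the terms absorb initial datum, source, Dirichlet
  -- datum and flux. Where `v` exceeds it, `v > 0`, so `a t * v ≥ c * v` and `κ * v 0 t > 0`; this
  -- supplies the strict inequalities.
  have hZ : IsRegular (fun x t => A * Real.exp (-σ * t) + (R / c + D + E * (1 - x)) * 1)
      (fun x t => 0 * Real.exp (-σ * t) + (E * -1) * 1)
      (fun x t => 0 * Real.exp (-σ * t) + 0 * 1)
      (fun x t => A * (Real.exp (-σ * t) * (-σ * 1)) + (R / c + D + E * (1 - x)) * 0) := by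
    refine (IsRegular.of_mul (fun x => hasDerivAt_const _ _) (fun x => hasDerivAt_const _ _)
      continuous_const (fun t => ?_) (by fun_prop)).add
      (IsRegular.of_mul (fun x => ?_) (fun x => hasDerivAt_const _ _) continuous_const
      (fun t => hasDerivAt_const _ _) continuous_const)
    · exact ((hasDerivAt_id t).const_mul (-σ)).exp
    · exact (((hasDerivAt_id x).const_sub 1).const_mul E).const_add (R / c + D)
  have hRc : 0 ≤ R / c := div_nonneg hR hc.le
  have hZ0 : ∀ x ∈ Icc (0 : ℝ) 1, ∀ t,
      0 ≤ A * Real.exp (-σ * t) + (R / c + D + E * (1 - x)) * 1 := fun x hx t => by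
    have := mul_nonneg hA (Real.exp_pos (-σ * t)).le
    have := mul_nonneg hE (sub_nonneg.2 hx.2)
    linarith
  have hy := hv.sub (hZ.isInteriorRegular T)
  have key := hy.nonpos ?_ ?_ ?_ ?_
  · intro x hx t ht
    have h1 := key x hx t ht
    nlinarith [mul_nonneg hE hx.1]
  · intro x hx t ht hpos
    have h1 := (abs_le.1 (hpde x hx t ht)).2
    have h2 := hZ0 x (Ioo_subset_Icc_self hx) t
    have h3 : c * v x t ≤ a t * v x t :=
      mul_le_mul_of_nonneg_right (ha t ht) (by linarith)
    have h4 : c * (A * Real.exp (-σ * t) + (R / c + D + E * (1 - x)) * 1) < c * v x t :=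
      mul_lt_mul_of_pos_left (by linarith) hc
    have h5 : c * (R / c) = R := mul_div_cancel₀ R hc.ne'
    have h6 : σ * (A * Real.exp (-σ * t)) ≤ c * (A * Real.exp (-σ * t)) :=
      mul_le_mul_of_nonneg_right hσ (mul_nonneg hA (Real.exp_pos _).le)
    have h7 : 0 ≤ c * (D + E * (1 - x)) := mul_nonneg hc.le
      (add_nonneg hD (mul_nonneg hE (sub_nonneg.2 hx.2.le)))
    nlinarith
  · intro t ht hpos
    have h2 := hZ0 0 ⟨le_rfl, zero_le_one⟩ t
    have h3 := (abs_le.1 (hg t ht)).1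
    have h4 : 0 < κ * v 0 t := mul_pos hκ (by linarith)
    exact ⟨_, by linarith, (hleft t ht).sub (hZ.deriv_x 0 t).hasDerivWithinAt⟩
  · intro t ht
    have := mul_nonneg hA (Real.exp_pos (-σ * t)).le
    linarith [(abs_le.1 (hright t ht)).2]
  · intro x hx
    have := mul_nonneg hE (sub_nonneg.2 hx.2)
    have h := (abs_le.1 (hinit x hx)).2
    simp only [mul_zero, Real.exp_zero]
    linarith

theorem abs_le_of_damped (hv : IsInteriorRegular T v vx vxx vt) {a ĝ : ℝ → ℝ}
    {c σ κ A R E D : ℝ}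
    (hσ : σ ≤ c) (hc : 0 < c) (hκ : 0 < κ) (hA : 0 ≤ A) (hR : 0 ≤ R) (hE : 0 ≤ E) (hD : 0 ≤ D)
    (ha : ∀ t ∈ Ioc 0 T, c ≤ a t)
    (hpde : ∀ x ∈ Ioo (0 : ℝ) 1, ∀ t ∈ Ioc 0 T, |vt x t - vxx x t + a t * v x t| ≤ R)
    (hleft : ∀ t ∈ Ioc 0 T, HasDerivWithinAt (fun x => v x t) (κ * v 0 t + ĝ t) (Icc 0 1) 0)
    (hg : ∀ t ∈ Ioc 0 T, |ĝ t| ≤ E)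
    (hright : ∀ t ∈ Ioc 0 T, |v 1 t| ≤ D) (hinit : ∀ x ∈ Icc (0 : ℝ) 1, |v x 0| ≤ A) :
    ∀ x ∈ Icc (0 : ℝ) 1, ∀ t ∈ Icc 0 T, |v x t| ≤ Real.exp (-σ * t) * A + R / c + D + E := by
  intro x hx t ht
  refine abs_le'.2 ⟨hv.le_of_damped hσ hc hκ hA hR hE hD ha hpde hleft hg hright hinit x hx t ht,
    hv.neg.le_of_damped (a := a) (ĝ := fun t => -ĝ t) hσ hc hκ hA hR hE hD ha
      (fun x hx t ht => ?_) (fun t ht => ?_) (fun t ht => ?_) (fun t ht => ?_)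
      (fun x hx => ?_) x hx t ht⟩
  · rw [show -vt x t - -vxx x t + a t * -v x t = -(vt x t - vxx x t + a t * v x t) by ring,
      abs_neg]
    exact hpde x hx t ht
  · rw [show κ * -v 0 t + -ĝ t = -(κ * v 0 t + ĝ t) by ring]
    exact (hleft t ht).neg
  · rw [abs_neg]; exact hg t ht
  · rw [abs_neg]; exact hright t ht
  · rw [abs_neg]; exact hinit x hx

end IsInteriorRegular

/-! ### Approximation by regular functions -/

/-- The products `t ^ j * cos (k π x / 2)` on a set of points `(x, t)`. -/
def cosMonomial (K : Set (ℝ × ℝ)) (j k : ℕ) : C(K, ℝ) :=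
  ⟨fun y => y.1.2 ^ j * Real.cos (k * (Real.pi / 2 * y.1.1)), by fun_prop⟩

def cosSpan (K : Set (ℝ × ℝ)) : Submodule ℝ C(K, ℝ) :=
  Submodule.span ℝ (range fun i : ℕ × ℕ => cosMonomial K i.1 i.2)

theorem cosMonomial_mem (K : Set (ℝ × ℝ)) (j k : ℕ) : cosMonomial K j k ∈ cosSpan K :=
  Submodule.subset_span ⟨(j, k), rfl⟩

/-- Product-to-sum formula. The order of `k` and `k'` only makes `k - k'` a true natural
subtraction. -/
theorem cosMonomial_mul_mem (K : Set (ℝ × ℝ)) {j k j' k' : ℕ} (h : k' ≤ k) :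
    cosMonomial K j k * cosMonomial K j' k' ∈ cosSpan K := by
  have : cosMonomial K j k * cosMonomial K j' k' = (1 / 2 : ℝ) • cosMonomial K (j + j') (k + k')
      + (1 / 2 : ℝ) • cosMonomial K (j + j') (k - k') := by
    ext y
    simp only [cosMonomial, ContinuousMap.coe_mul, ContinuousMap.coe_mk, Pi.mul_apply,
      ContinuousMap.coe_add, ContinuousMap.coe_smul, Pi.add_apply, Pi.smul_apply, smul_eq_mul]
    push_cast [h]
    rw [add_mul, sub_mul, Real.cos_add, Real.cos_sub, pow_add]
    ring
  rw [this]
  exact add_mem (Submodule.smul_mem _ _ (cosMonomial_mem K _ _))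
    (Submodule.smul_mem _ _ (cosMonomial_mem K _ _))

theorem cosSpan_one_mem (K : Set (ℝ × ℝ)) : (1 : C(K, ℝ)) ∈ cosSpan K := by
  have : (1 : C(K, ℝ)) = cosMonomial K 0 0 := by ext y; simp [cosMonomial]
  rw [this]; exact cosMonomial_mem K 0 0

theorem cosSpan_mul_mem (K : Set (ℝ × ℝ)) (f g : C(K, ℝ)) (hf : f ∈ cosSpan K)
    (hg : g ∈ cosSpan K) : f * g ∈ cosSpan K := by
  have h : cosSpan K * cosSpan K ≤ cosSpan K := by
    unfold cosSpan
    rw [Submodule.span_mul_span, Submodule.span_le]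
    rintro _ ⟨_, ⟨⟨j, k⟩, rfl⟩, _, ⟨⟨j', k'⟩, rfl⟩, rfl⟩
    rcases le_total k' k with h | h
    · exact cosMonomial_mul_mem K h
    · show cosMonomial K j k * cosMonomial K j' k' ∈ cosSpan K
      rw [mul_comm]; exact cosMonomial_mul_mem K h
  exact h (Submodule.mul_mem_mul hf hg)

/-- Stone–Weierstrass: `t` separates times, and `cos (π x / 2)` is injective on `[0, 2]`. -/
theorem exists_cosSpan_near {T ε : ℝ} (hε : 0 < ε) {f : ℝ → ℝ → ℝ}
    (hf : ContinuousOn (Function.uncurry f) (Icc 0 2 ×ˢ Icc 0 T)) :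
    ∃ g ∈ cosSpan (Icc 0 2 ×ˢ Icc 0 T), ∀ y : ↥(Icc (0 : ℝ) 2 ×ˢ Icc (0 : ℝ) T),
      |g y - f y.1.1 y.1.2| < ε := by
  have : CompactSpace ↥(Icc (0 : ℝ) 2 ×ˢ Icc (0 : ℝ) T) :=
    isCompact_iff_compactSpace.1 (isCompact_Icc.prod isCompact_Icc)
  let A := (cosSpan (Icc (0 : ℝ) 2 ×ˢ Icc (0 : ℝ) T)).toSubalgebra (cosSpan_one_mem _)
    (cosSpan_mul_mem _)
  have hA : A.SeparatesPoints := by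
    rintro ⟨⟨x, t⟩, hx, ht⟩ ⟨⟨x', t'⟩, hx', ht'⟩ hne
    simp only at hx ht hx' ht'
    by_cases hxx : x = x'
    · refine ⟨_, ⟨cosMonomial _ 1 0, cosMonomial_mem _ 1 0, rfl⟩, ?_⟩
      simp only [cosMonomial, ContinuousMap.coe_mk]
      intro h
      apply hne
      simp at h
      simp [hxx, h]
    · refine ⟨_, ⟨cosMonomial _ 0 1, cosMonomial_mem _ 0 1, rfl⟩, ?_⟩
      simp only [cosMonomial, ContinuousMap.coe_mk]
      intro h
      simp only [pow_zero, one_mul, Nat.cast_one] at h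
      have hpi := Real.pi_pos
      have := Real.injOn_cos (show Real.pi / 2 * x ∈ Icc 0 Real.pi from
        ⟨by have := hx.1; positivity, by nlinarith [hx.2]⟩)
        (show Real.pi / 2 * x' ∈ Icc 0 Real.pi from
        ⟨by have := hx'.1; positivity, by nlinarith [hx'.2]⟩) h
      exact hxx (mul_left_cancel₀ (by positivity) this)
  obtain ⟨g, hg⟩ := ContinuousMap.exists_mem_subalgebra_near_continuous_of_separatesPoints A hA
    (fun y => f y.1.1 y.1.2) (continuousOn_iff_continuous_domRestrict.1 hf) ε hε
  exact ⟨g, g.2, hg⟩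

/-- Regular solutions of the inhomogeneous heat equation with zero initial and Neumann data. -/
theorem exists_regular_of_mem_cosSpan {K : Set (ℝ × ℝ)} {g : C(K, ℝ)} (hg : g ∈ cosSpan K) :
    ∃ v vx vxx vt : ℝ → ℝ → ℝ, IsRegular v vx vxx vt ∧ (∀ x, v x 0 = 0) ∧
      (∀ t, vx 0 t = 0) ∧ (∀ t, vx 2 t = 0) ∧
      ∀ y : K, vt y.1.1 y.1.2 - vxx y.1.1 y.1.2 = g y := by
  induction hg using Submodule.span_induction with
  | mem g hg =>
    obtain ⟨⟨j, k⟩, rfl⟩ := hg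
    set ω : ℝ := k * (Real.pi / 2) with hω
    -- Duhamel's formula: the solution with source `t ^ j cos (ω x)` is `cos (ω x) e^{-ω² t} ∫₀ᵗ
    -- e^{ω² s} s ^ j ds`. Its slope vanishes at `x = 2` because `2 ω` is a multiple of `π`.
    have hI : ∀ t, HasDerivAt (fun t => ∫ s in (0 : ℝ)..t, Real.exp (ω ^ 2 * s) * s ^ j)
        (Real.exp (ω ^ 2 * t) * t ^ j) t := fun t =>
      (by fun_prop : Continuous fun s : ℝ => Real.exp (ω ^ 2 * s) * s ^ j).integral_hasStrictDerivAt
        0 t |>.hasDerivAt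
    have hIc : Continuous fun t => ∫ s in (0 : ℝ)..t, Real.exp (ω ^ 2 * s) * s ^ j :=
      continuous_iff_continuousAt.2 fun t => (hI t).continuousAt
    have hcos : ∀ x, HasDerivAt (fun x => Real.cos (ω * x)) (-Real.sin (ω * x) * (ω * 1)) x :=
      fun x => ((hasDerivAt_id x).const_mul ω).cos
    have hsin : ∀ x, HasDerivAt (fun x => -Real.sin (ω * x) * (ω * 1))
        (-(Real.cos (ω * x) * (ω * 1)) * (ω * 1)) x :=
      fun x => ((hasDerivAt_id x).const_mul ω).sin.neg.mul_const (ω * 1)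
    have hexp : ∀ t, HasDerivAt (fun t => Real.exp (-ω ^ 2 * t))
        (Real.exp (-ω ^ 2 * t) * (-ω ^ 2 * 1)) t :=
      fun t => ((hasDerivAt_id t).const_mul (-ω ^ 2)).exp
    refine ⟨_, _, _, _, IsRegular.of_mul hcos hsin (by fun_prop)
      (fun t => (hexp t).mul (hI t)) ?_, ?_, ?_, ?_, ?_⟩
    · fun_prop
    · intro x; simp
    · intro t; simp
    · intro t
      have : ω * 2 = k * Real.pi := by rw [hω]; ring
      simp [this, Real.sin_nat_mul_pi]
    · rintro ⟨⟨x, t⟩, hy⟩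
      have h1 : Real.exp (-ω ^ 2 * t) * Real.exp (ω ^ 2 * t) = 1 := by
        rw [← Real.exp_add]; simp
      have h2 : (k : ℝ) * (Real.pi / 2 * x) = ω * x := by rw [hω]; ring
      simp only [cosMonomial, ContinuousMap.coe_mk, h2, Pi.mul_apply]
      linear_combination (Real.cos (ω * x) * t ^ j) * h1
  | zero =>
    refine ⟨_, _, _, _, IsRegular.of_mul (g := 0) (g' := 0) (g'' := 0) (h := 0) (h' := 0)
      (fun x => hasDerivAt_const _ _) (fun x => hasDerivAt_const _ _) continuous_const
      (fun x => hasDerivAt_const _ _) continuous_const, ?_, ?_, ?_, ?_⟩ <;> simp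
  | add g g' _ _ h h' =>
    obtain ⟨v, vx, vxx, vt, hv, h0, h1, h2, h3⟩ := h
    obtain ⟨v', vx', vxx', vt', hv', h0', h1', h2', h3'⟩ := h'
    refine ⟨_, _, _, _, hv.add hv', fun x => by simp [h0, h0'], fun t => by simp [h1, h1'],
      fun t => by simp [h2, h2'], fun y => ?_⟩
    rw [ContinuousMap.add_apply, ← h3, ← h3']; ring
  | smul c g _ h =>
    obtain ⟨v, vx, vxx, vt, hv, h0, h1, h2, h3⟩ := h
    refine ⟨_, _, _, _, hv.const_mul c, fun x => by simp [h0], fun t => by simp [h1],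
      fun t => by simp [h2], fun y => ?_⟩
    rw [ContinuousMap.smul_apply, ← h3, smul_eq_mul]; ring

/-- Regular solutions of the homogeneous heat equation with zero Neumann data. -/
theorem exists_regular_of_mem_cosSpan_initial {K : Set (ℝ × ℝ)} {g : C(K, ℝ)}
    (hg : g ∈ cosSpan K) :
    ∃ v vx vxx vt : ℝ → ℝ → ℝ, IsRegular v vx vxx vt ∧
      (∀ y : K, y.1.2 = 0 → v y.1.1 0 = g y) ∧
      (∀ t, vx 0 t = 0) ∧ (∀ t, vx 2 t = 0) ∧ ∀ x t, vt x t - vxx x t = 0 := by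
  induction hg using Submodule.span_induction with
  | mem g hg =>
    obtain ⟨⟨j, k⟩, rfl⟩ := hg
    set ω : ℝ := k * (Real.pi / 2) with hω
    have hcos : ∀ x, HasDerivAt (fun x => Real.cos (ω * x)) (-Real.sin (ω * x) * (ω * 1)) x :=
      fun x => ((hasDerivAt_id x).const_mul ω).cos
    have hsin : ∀ x, HasDerivAt (fun x => -Real.sin (ω * x) * (ω * 1))
        (-(Real.cos (ω * x) * (ω * 1)) * (ω * 1)) x :=
      fun x => ((hasDerivAt_id x).const_mul ω).sin.neg.mul_const (ω * 1)
    -- The factor `0 ^ j` is the value of `t ^ j` at `t = 0`, equal to `1` for `j = 0`.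
    have hexp : ∀ t, HasDerivAt (fun t => (0 : ℝ) ^ j * Real.exp (-ω ^ 2 * t))
        ((0 : ℝ) ^ j * (Real.exp (-ω ^ 2 * t) * (-ω ^ 2 * 1))) t :=
      fun t => ((hasDerivAt_id t).const_mul (-ω ^ 2)).exp.const_mul _
    refine ⟨_, _, _, _, IsRegular.of_mul hcos hsin (by fun_prop) hexp ?_, ?_, ?_, ?_, ?_⟩
    · fun_prop
    · rintro ⟨⟨x, t⟩, hy⟩ ht
      simp only at ht
      have h2 : (k : ℝ) * (Real.pi / 2 * x) = ω * x := by rw [hω]; ring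
      simp only [cosMonomial, ContinuousMap.coe_mk, h2, ht, mul_zero, Real.exp_zero, mul_one]
      exact mul_comm _ _
    · intro t; simp
    · intro t
      have : ω * 2 = k * Real.pi := by rw [hω]; ring
      simp [this, Real.sin_nat_mul_pi]
    · intro x t; ring
  | zero =>
    refine ⟨_, _, _, _, IsRegular.of_mul (g := 0) (g' := 0) (g'' := 0) (h := 0) (h' := 0)
      (fun x => hasDerivAt_const _ _) (fun x => hasDerivAt_const _ _) continuous_const
      (fun x => hasDerivAt_const _ _) continuous_const, ?_, ?_, ?_, ?_⟩ <;> simp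
  | add g g' _ _ h h' =>
    obtain ⟨v, vx, vxx, vt, hv, h0, h1, h2, h3⟩ := h
    obtain ⟨v', vx', vxx', vt', hv', h0', h1', h2', h3'⟩ := h'
    refine ⟨_, _, _, _, hv.add hv', fun y hy => by simp [h0 y hy, h0' y hy],
      fun t => by simp [h1, h1'], fun t => by simp [h2, h2'],
      fun x t => by linear_combination h3 x t + h3' x t⟩
  | smul c g _ h =>
    obtain ⟨v, vx, vxx, vt, hv, h0, h1, h2, h3⟩ := h
    refine ⟨_, _, _, _, hv.const_mul c, fun y hy => by simp [h0 y hy],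
      fun t => by simp [h1], fun t => by simp [h2], fun x t => by linear_combination c * h3 x t⟩

/-- Approximate regular solutions of the heat equation with prescribed source and initial
datum, both vanishing at `x = 1`, and with homogeneous mixed boundary conditions. -/
theorem exists_regular_near_of_right_zero {T ε : ℝ} (hT : 0 ≤ T) (hε : 0 < ε) {h : ℝ → ℝ → ℝ}
    {h₀ : ℝ → ℝ} (hh : ContinuousOn (Function.uncurry h) (Icc 0 1 ×ˢ Icc 0 T))
    (hh₀ : ContinuousOn h₀ (Icc 0 1)) (h1 : ∀ t ∈ Icc 0 T, h 1 t = 0) (h₀1 : h₀ 1 = 0) :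
    ∃ v vx vxx vt : ℝ → ℝ → ℝ, IsRegular v vx vxx vt ∧
      (∀ x ∈ Icc (0 : ℝ) 1, ∀ t ∈ Icc 0 T, |vt x t - vxx x t - h x t| ≤ ε) ∧
      (∀ x ∈ Icc (0 : ℝ) 1, |v x 0 - h₀ x| ≤ ε) ∧ (∀ t, vx 0 t = 0) ∧ ∀ t, v 1 t = 0 := by
  have maps : ∀ x ∈ Icc (0 : ℝ) 2, min x 1 ∈ Icc (0 : ℝ) 1 ∧ min (2 - x) 1 ∈ Icc (0 : ℝ) 1 :=
    fun x hx => ⟨⟨le_min hx.1 zero_le_one, min_le_right _ _⟩,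
      le_min (by linarith [hx.2]) zero_le_one, min_le_right _ _⟩
  -- Odd reflection about `x = 1`, written with `min`: it equals `h x t` for `x ≤ 1` and `-h (2 - x)
  -- t` for `x ≥ 1`, since `h 1 t = 0`.
  have hE : ContinuousOn (Function.uncurry fun x t => h (min x 1) t - h (min (2 - x) 1) t)
      (Icc 0 2 ×ˢ Icc 0 T) := by
    refine ContinuousOn.sub ?_ ?_
    · exact hh.comp (f := fun y : ℝ × ℝ => (min y.1 1, y.2)) (by fun_prop)
        fun y hy => ⟨(maps y.1 hy.1).1, hy.2⟩
    · exact hh.comp (f := fun y : ℝ × ℝ => (min (2 - y.1) 1, y.2)) (by fun_prop)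
        fun y hy => ⟨(maps y.1 hy.1).2, hy.2⟩
  have hE₀ : ContinuousOn (Function.uncurry fun x (_ : ℝ) => h₀ (min x 1) - h₀ (min (2 - x) 1))
      (Icc 0 2 ×ˢ Icc 0 T) := by
    refine ContinuousOn.sub ?_ ?_
    · exact hh₀.comp (f := fun y : ℝ × ℝ => min y.1 1) (by fun_prop)
        fun y hy => (maps y.1 hy.1).1
    · exact hh₀.comp (f := fun y : ℝ × ℝ => min (2 - y.1) 1) (by fun_prop)
        fun y hy => (maps y.1 hy.1).2
  obtain ⟨g, hg, hgn⟩ := exists_cosSpan_near hε hE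
  obtain ⟨g₀, hg₀, hgn₀⟩ := exists_cosSpan_near hε hE₀
  obtain ⟨v, vx, vxx, vt, hv, hv0, hvl, hvr, hvg⟩ := exists_regular_of_mem_cosSpan hg
  obtain ⟨w, wx, wxx, wt, hw, hw0, hwl, hwr, hwg⟩ := exists_regular_of_mem_cosSpan_initial hg₀
  have hs := hv.add hw
  -- The odd part `(s(x) - s(2 - x)) / 2` vanishes at `x = 1` and keeps zero slope at `0`, because
  -- `s` has zero slope at both `0` and `2`. Averaging two errors keeps the bound `ε`.
  refine ⟨_, _, _, _, (hs.add ((hs.reflect 2).const_mul (-1))).const_mul (1 / 2), ?_, ?_, ?_, ?_⟩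
  · intro x hx t ht
    have a1 := hvg ⟨(x, t), ⟨hx.1, by linarith [hx.2]⟩, ht⟩
    have a2 := hvg ⟨(2 - x, t), ⟨by linarith [hx.2], by linarith [hx.1]⟩, ht⟩
    have b1 := hgn ⟨(x, t), ⟨hx.1, by linarith [hx.2]⟩, ht⟩
    have b2 := hgn ⟨(2 - x, t), ⟨by linarith [hx.2], by linarith [hx.1]⟩, ht⟩
    rw [← a1] at b1
    rw [← a2] at b2
    simp only [min_eq_left hx.2, min_eq_right (by linarith [hx.2] : (1 : ℝ) ≤ 2 - x), h1 t ht,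
      sub_sub_cancel] at b1 b2
    rw [abs_lt] at b1 b2
    have c1 := hwg x t
    have c2 := hwg (2 - x) t
    rw [abs_le]
    constructor <;> linarith [b1.1, b1.2, b2.1, b2.2]
  · intro x hx
    have a1 := hw0 ⟨(x, 0), ⟨hx.1, by linarith [hx.2]⟩, le_rfl, hT⟩ rfl
    have a2 := hw0 ⟨(2 - x, 0), ⟨by linarith [hx.2], by linarith [hx.1]⟩, le_rfl, hT⟩ rfl
    have b1 := hgn₀ ⟨(x, 0), ⟨hx.1, by linarith [hx.2]⟩, le_rfl, hT⟩
    have b2 := hgn₀ ⟨(2 - x, 0), ⟨by linarith [hx.2], by linarith [hx.1]⟩, le_rfl, hT⟩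
    rw [← a1] at b1
    rw [← a2] at b2
    simp only [min_eq_left hx.2, min_eq_right (by linarith [hx.2] : (1 : ℝ) ≤ 2 - x), h₀1,
      sub_sub_cancel] at b1 b2
    rw [abs_lt] at b1 b2
    simp only [hv0]
    rw [abs_le]
    constructor <;> linarith [b1.1, b1.2, b2.1, b2.2]
  · intro t
    simp [hvl, hvr, hwl, hwr]
  · intro t
    norm_num

/-- Approximate regular solutions of the heat equation with prescribed continuous source,
initial, flux and Dirichlet data. -/
theorem exists_regular_near {T ε : ℝ} (hT : 0 ≤ T) (hε : 0 < ε) {F : ℝ → ℝ → ℝ}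
    {u₀ G d : ℝ → ℝ} (hF : ContinuousOn (Function.uncurry F) (Icc 0 1 ×ˢ Icc 0 T))
    (hu₀ : ContinuousOn u₀ (Icc 0 1)) (hG : ContinuousOn G (Icc 0 T))
    (hd : ContinuousOn d (Icc 0 T)) (hcomp : u₀ 1 = d 0) :
    ∃ v vx vxx vt : ℝ → ℝ → ℝ, IsRegular v vx vxx vt ∧
      (∀ x ∈ Icc (0 : ℝ) 1, ∀ t ∈ Icc 0 T, |vt x t - vxx x t - F x t| ≤ ε) ∧
      (∀ x ∈ Icc (0 : ℝ) 1, |v x 0 - u₀ x| ≤ ε) ∧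
      (∀ t ∈ Icc 0 T, |vx 0 t - G t| ≤ ε) ∧ ∀ t ∈ Icc 0 T, |v 1 t - d t| ≤ ε := by
  have hε2 : 0 < ε / 2 := half_pos hε
  have hF1 : ContinuousOn (F 1) (Icc 0 T) :=
    hF.comp (f := fun t : ℝ => ((1 : ℝ), t)) (by fun_prop) fun t ht => ⟨by simp, ht⟩
  obtain ⟨P, hP⟩ := exists_polynomial_near_of_continuousOn 0 T (F 1) hF1 _ hε2
  obtain ⟨Q, hQ⟩ := exists_polynomial_near_of_continuousOn 0 T G hG _ hε
  obtain ⟨A, hA⟩ := exists_polynomial_near_of_continuousOn 0 T d hd _ hε2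
  -- Lifting `a = A + (x - 1)(Q + C) + (x - 1)² C / 2` with `C = A' - P`. It carries the Dirichlet
  -- datum `A`, the flux `Q`, and the source trace `P` at `x = 1`.
  have ha : ∃ a ax axx at' : ℝ → ℝ → ℝ, IsRegular a ax axx at' ∧ (∀ t, a 1 t = A.eval t) ∧
      (∀ t, ax 0 t = Q.eval t) ∧ ∀ t, at' 1 t - axx 1 t = P.eval t := by
    set C := Polynomial.derivative A - P with hC
    refine ⟨_, _, _, _, ((IsRegular.of_mul (g := fun _ => 1) (fun x => hasDerivAt_const _ _)
      (fun x => hasDerivAt_const _ _) continuous_const (fun t => A.hasDerivAt t)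
      (Polynomial.continuous _)).add
      (IsRegular.of_mul (g := fun x => x - 1) (g' := fun x => 1)
      (fun x => (hasDerivAt_id x).sub_const 1)
      (fun x => hasDerivAt_const _ _) continuous_const (fun t => (Q + C).hasDerivAt t)
      (Polynomial.continuous _))).add
      (IsRegular.of_mul (g := fun x => (x - 1) ^ 2 / 2) (g' := fun x => x - 1)
      (g'' := fun x => 1) (fun x => ?_)
      (fun x => (hasDerivAt_id x).sub_const 1) continuous_const (fun t => C.hasDerivAt t)
      (Polynomial.continuous _)), ?_, ?_, ?_⟩
    · exact ((((hasDerivAt_id x).sub_const 1).pow 2).div_const 2).congr_deriv (by simp)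
    · intro t; simp
    · intro t; simp
    · intro t; simp [hC]
  obtain ⟨a, ax, axx, at', har, ha1, ha0, hap⟩ := ha
  have hres : Continuous (Function.uncurry fun x t => at' x t - axx x t) :=
    har.cont_t.sub har.cont_xx
  -- Subtracting the trace at `x = 1` makes the remaining source vanish there exactly; the trace is
  -- below `ε / 2` because `P` approximates `F 1`. The initial datum is treated alike, using `u₀ 1 =
  -- d 0`.
  have hh : ContinuousOn (Function.uncurry fun x t =>
      (F x t - (at' x t - axx x t)) - (F 1 t - (at' 1 t - axx 1 t))) (Icc 0 1 ×ˢ Icc 0 T) := by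
    have h := hF.sub hres.continuousOn
    exact h.sub (h.comp (f := fun y : ℝ × ℝ => ((1 : ℝ), y.2)) (by fun_prop)
      fun y hy => ⟨by simp, hy.2⟩)
  have hh₀ : ContinuousOn (fun x => (u₀ x - a x 0) - (u₀ 1 - a 1 0)) (Icc 0 1) := by
    refine (hu₀.sub (Continuous.continuousOn ?_)).sub continuousOn_const
    exact har.cont.comp (continuous_id.prodMk continuous_const)
  obtain ⟨v, vx, vxx, vt, hv, hvp, hv0, hvl, hvr⟩ :=
    exists_regular_near_of_right_zero hT hε2 hh hh₀ (fun t _ => sub_self _) (sub_self _)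
  refine ⟨_, _, _, _, har.add hv, ?_, ?_, ?_, ?_⟩
  · intro x hx t ht
    have h1 := abs_le.1 (hvp x hx t ht)
    have h2 := abs_lt.1 (hP t ht)
    have h3 := hap t
    rw [abs_le]
    constructor <;> linarith [h1.1, h1.2, h2.1, h2.2]
  · intro x hx
    have h1 := abs_le.1 (hv0 x hx)
    have h2 := abs_lt.1 (hA 0 ⟨le_rfl, hT⟩)
    have h3 := ha1 0
    rw [abs_le]
    constructor <;> linarith [h1.1, h1.2, h2.1, h2.2]
  · intro t ht
    simp only [hvl, ha0, add_zero]
    exact (hQ t ht).le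
  · intro t ht
    simp only [hvr, ha1, add_zero]
    linarith [hA t ht]

/-! ### Differentiation of integrals with variable limits -/

theorem hasDerivAt_integral_param {h g : ℝ → ℝ → ℝ} (hh : Continuous (Function.uncurry h))
    (hg : Continuous (Function.uncurry g)) (hd : ∀ x z, HasDerivAt (fun y => h y z) (g x z) x)
    (a b x : ℝ) :
    HasDerivAt (fun y => ∫ z in a..b, h y z) (∫ z in a..b, g x z) x := by
  obtain ⟨C, hC⟩ := ((isCompact_Icc (a := x - 1) (b := x + 1)).prod
    (isCompact_uIcc (a := a) (b := b))).exists_bound_of_continuousOn hg.continuousOn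
  have hslice : ∀ {k : ℝ → ℝ → ℝ}, Continuous (Function.uncurry k) → ∀ y, Continuous (k y) :=
    fun hk y => hk.comp (continuous_const.prodMk continuous_id)
  refine (intervalIntegral.hasDerivAt_integral_of_dominated_loc_of_deriv_le
    (bound := fun _ => C) (F := h) (F' := g) (s := Icc (x - 1) (x + 1))
    (Icc_mem_nhds (by linarith) (by linarith)) ?_ ?_ ?_ ?_ ?_ ?_).2
  · exact Eventually.of_forall fun y => (hslice hh y).aestronglyMeasurable
  · exact (hslice hh x).intervalIntegrable _ _
  · exact (hslice hg x).aestronglyMeasurable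
  · exact Eventually.of_forall fun z hz y hy => hC (y, z) ⟨hy, uIoc_subset_uIcc hz⟩
  · exact intervalIntegrable_const
  · exact Eventually.of_forall fun z _ y _ => hd y z

/-- The lower limit is the base point, so the variation of the integrand contributes only `o(y - x)`
and continuity of `h` suffices. -/
theorem hasDerivAt_integral_endpoint {h : ℝ → ℝ → ℝ} (hh : Continuous (Function.uncurry h))
    (x : ℝ) : HasDerivAt (fun y => ∫ z in x..y, h y z) (h x x) x := by
  rw [hasDerivAt_iff_isLittleO, Asymptotics.isLittleO_iff]
  intro ε hε
  obtain ⟨δ, hδ, hball⟩ := Metric.continuousAt_iff.1 (hh.continuousAt (x := (x, x))) ε hε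
  filter_upwards [Metric.ball_mem_nhds x hδ] with y hy
  have hc : Continuous (h y) := hh.comp (continuous_const.prodMk continuous_id)
  have h1 : (∫ z in x..y, h y z) - (∫ z in x..x, h x z) - (y - x) • h x x
      = ∫ z in x..y, (h y z - h x x) := by
    rw [intervalIntegral.integral_sub (hc.intervalIntegrable _ _) intervalIntegrable_const,
      intervalIntegral.integral_const, intervalIntegral.integral_same, sub_zero]
  rw [h1]
  refine intervalIntegral.norm_integral_le_of_norm_le_const fun z hz => ?_
  have hzy : |z - x| ≤ |y - x| := abs_sub_left_of_mem_uIcc (uIoc_subset_uIcc hz)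
  have := @hball (y, z) (by
    rw [Prod.dist_eq]
    refine max_lt hy ?_
    rw [Metric.mem_ball, Real.dist_eq] at hy
    simpa only [Real.dist_eq] using hzy.trans_lt hy)
  rw [Real.dist_eq] at this
  exact this.le

theorem hasDerivAt_integral_variable {h g : ℝ → ℝ → ℝ} (hh : Continuous (Function.uncurry h))
    (hg : Continuous (Function.uncurry g)) (hd : ∀ x z, HasDerivAt (fun y => h y z) (g x z) x)
    (a x : ℝ) :
    HasDerivAt (fun y => ∫ z in a..y, h y z) (h x x + ∫ z in a..x, g x z) x := by
  have hsum := (hasDerivAt_integral_param hh hg hd a x x).add (hasDerivAt_integral_endpoint hh x)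
  refine (hsum.congr_deriv (add_comm _ _)).congr_of_eventuallyEq (Eventually.of_forall fun y => ?_)
  have hc : Continuous (h y) := hh.comp (continuous_const.prodMk continuous_id)
  exact (intervalIntegral.integral_add_adjacent_intervals (hc.intervalIntegrable _ _)
    (hc.intervalIntegrable _ _)).symm

/-! ### Functions on the triangle -/

/-- A continuous retraction of the plane onto the triangle. -/
def toTriangle (x z : ℝ) : ℝ × ℝ := (max 0 (min x 1), max 0 (min z (max 0 (min x 1))))

theorem toTriangle_mem (x z : ℝ) : toTriangle x z ∈ triangle :=
  ⟨le_max_left _ _, max_le (le_max_left _ _) (min_le_right _ _),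
    max_le zero_le_one (min_le_right _ _)⟩

theorem toTriangle_of_mem {x z : ℝ} (h : (x, z) ∈ triangle) : toTriangle x z = (x, z) := by
  obtain ⟨h1, h2, h3⟩ := h
  simp only at h1 h2 h3
  simp [toTriangle, min_eq_left h3, max_eq_right (h1.trans h2), min_eq_left h2, max_eq_right h1]

theorem continuous_toTriangle : Continuous (Function.uncurry toTriangle) := by
  unfold toTriangle Function.uncurry
  fun_prop

/-- Extension of a function on the triangle to the plane. -/
def extend (k : ℝ × ℝ → ℝ) (x z : ℝ) : ℝ := k (toTriangle x z)

theorem extend_of_mem (k : ℝ × ℝ → ℝ) {x z : ℝ} (h : (x, z) ∈ triangle) :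
    extend k x z = k (x, z) := by
  rw [extend, toTriangle_of_mem h]

theorem continuous_extend {k : ℝ × ℝ → ℝ} (hk : ContinuousOn k triangle) :
    Continuous (Function.uncurry (extend k)) :=
  hk.comp_continuous continuous_toTriangle fun y => toTriangle_mem y.1 y.2

theorem isCompact_triangle : IsCompact triangle := by
  have h : triangle = Function.uncurry toTriangle '' (Icc (0 : ℝ) 1 ×ˢ Icc (0 : ℝ) 1) := by
    ext ⟨x, z⟩
    constructor
    · intro h
      exact ⟨(x, z), ⟨⟨h.1.trans h.2.1, h.2.2⟩, h.1, h.2.1.trans h.2.2⟩, toTriangle_of_mem h⟩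
    · rintro ⟨y, -, hy⟩
      rw [← hy]
      exact toTriangle_mem _ _
  rw [h]
  exact (isCompact_Icc.prod isCompact_Icc).image continuous_toTriangle

theorem triangle_mem_nhds {x z : ℝ} (hz : 0 < z) (hzx : z < x) (hx : x < 1) :
    triangle ∈ 𝓝 (x, z) := by
  have h : IsOpen {y : ℝ × ℝ | 0 < y.2 ∧ y.2 < y.1 ∧ y.1 < 1} :=
    (isOpen_lt continuous_const continuous_snd).inter
      ((isOpen_lt continuous_snd continuous_fst).inter (isOpen_lt continuous_fst continuous_const))
  exact mem_of_superset (h.mem_nhds ⟨hz, hzx, hx⟩) fun y hy => ⟨hy.1.le, hy.2.1.le, hy.2.2.le⟩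

theorem uniqueDiffOn_triangle : UniqueDiffOn ℝ triangle := by
  refine uniqueDiffOn_convex ?_ ⟨(2 / 3, 1 / 3), ?_⟩
  · intro y hy z hz a b ha hb hab
    obtain ⟨h1, h2, h3⟩ := hy
    obtain ⟨h4, h5, h6⟩ := hz
    refine ⟨?_, ?_, ?_⟩ <;> simp only [Prod.snd_add, Prod.smul_snd, Prod.fst_add, Prod.smul_fst,
      smul_eq_mul]
    · positivity
    · nlinarith
    · nlinarith
  · exact mem_interior_iff_mem_nhds.2
      (triangle_mem_nhds (by norm_num) (by norm_num) (by norm_num))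

/-! ### Calculus of kernels: Leibniz rule and integration by parts. -/

section Differentiable

variable {k : ℝ × ℝ → ℝ}

theorem contDiffOn_kx {n m : WithTop ℕ∞} (hk : ContDiffOn ℝ n k triangle) (h : m + 1 ≤ n) :
    ContDiffOn ℝ m (kx k) triangle :=
  (hk.fderivWithin uniqueDiffOn_triangle h).clm_apply contDiffOn_const

theorem contDiffOn_kz {n m : WithTop ℕ∞} (hk : ContDiffOn ℝ n k triangle) (h : m + 1 ≤ n) :
    ContDiffOn ℝ m (kz k) triangle :=
  (hk.fderivWithin uniqueDiffOn_triangle h).clm_apply contDiffOn_const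

theorem hasDerivAt_fst (hk : ContDiffOn ℝ 1 k triangle) {x z : ℝ} (hz : 0 < z) (hzx : z < x)
    (hx : x < 1) : HasDerivAt (fun y => k (y, z)) (kx k (x, z)) x := by
  have hn := triangle_mem_nhds hz hzx hx
  have h := ((hk.differentiableOn one_ne_zero _ (mem_of_mem_nhds hn)).hasFDerivWithinAt).hasFDerivAt
    hn
  exact h.comp_hasDerivAt (f := fun y : ℝ => (y, z)) x
    ((hasDerivAt_id x).prodMk (hasDerivAt_const x z))

theorem hasDerivAt_snd (hk : ContDiffOn ℝ 1 k triangle) {x z : ℝ} (hz : 0 < z) (hzx : z < x)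
    (hx : x < 1) : HasDerivAt (fun y => k (x, y)) (kz k (x, z)) z := by
  have hn := triangle_mem_nhds hz hzx hx
  have h := ((hk.differentiableOn one_ne_zero _ (mem_of_mem_nhds hn)).hasFDerivWithinAt).hasFDerivAt
    hn
  exact h.comp_hasDerivAt (f := fun y : ℝ => (x, y)) z
    ((hasDerivAt_const z x).prodMk (hasDerivAt_id z))

theorem hasDerivWithinAt_diag (hk : ContDiffOn ℝ 1 k triangle) {x : ℝ} (hx : x ∈ Icc (0 : ℝ) 1) :
    HasDerivWithinAt (fun y => k (y, y)) (kx k (x, x) + kz k (x, x)) (Icc 0 1) x := by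
  have h := (hk.differentiableOn one_ne_zero (x, x) ⟨hx.1, le_rfl, hx.2⟩).hasFDerivWithinAt
  have h2 := h.comp_hasDerivWithinAt (f := fun y : ℝ => (y, y)) (s := Icc 0 1) x
    ((hasDerivAt_id x).prodMk (hasDerivAt_id x)).hasDerivWithinAt
    (fun y hy => ⟨hy.1, le_rfl, hy.2⟩)
  refine h2.congr_deriv ?_
  rw [kx, kz, ← map_add]
  simp

theorem hasDerivAt_integral_kernel (hk : ContDiffOn ℝ 1 k triangle) {φ : ℝ → ℝ}
    (hφ : Continuous φ) {x : ℝ} (hx : x ∈ Ioo (0 : ℝ) 1) :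
    HasDerivAt (fun y => ∫ z in (0 : ℝ)..y, extend k y z * φ z)
      (k (x, x) * φ x + ∫ z in (0 : ℝ)..x, extend (kx k) x z * φ z) x := by
  have hkx : Continuous (Function.uncurry (extend (kx k))) :=
    continuous_extend (contDiffOn_kx (m := 0) hk (by norm_num)).continuousOn
  have hkc : Continuous (Function.uncurry (extend k)) := continuous_extend hk.continuousOn
  have hsw : Continuous (Function.uncurry fun z y => extend (kx k) y z) :=
    hkx.comp continuous_swap
  -- `extend k` is continuous but need not be differentiable in `y` across the diagonal. Rebuilding
  -- `k (y, z)` from its diagonal value and the integral of `kx k` gives an integrand differentiable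
  -- in `y` everywhere, which agrees with the original for `0 < z ≤ y < 1`.
  let h : ℝ → ℝ → ℝ := fun y z => (extend k z z + ∫ s in z..y, extend (kx k) s z) * φ z
  have hh : Continuous (Function.uncurry h) := by
    have e : ∀ y z, (∫ s in z..y, extend (kx k) s z)
        = (∫ s in (0 : ℝ)..y, extend (kx k) s z) - ∫ s in (0 : ℝ)..z, extend (kx k) s z := by
      intro y z
      have hc : Continuous fun s => extend (kx k) s z :=
        hkx.comp (continuous_id.prodMk continuous_const)
      rw [intervalIntegral.integral_interval_sub_left (hc.intervalIntegrable _ _)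
        (hc.intervalIntegrable _ _)]
    simp only [h, e]
    have c1 : Continuous fun y : ℝ × ℝ => ∫ s in (0 : ℝ)..y.1, extend (kx k) s y.2 :=
      intervalIntegral.continuous_parametric_intervalIntegral_of_continuous
        (f := fun (y : ℝ × ℝ) s => extend (kx k) s y.2)
        (hkx.comp (continuous_snd.prodMk (continuous_snd.comp continuous_fst))) continuous_fst
    have c2 : Continuous fun y : ℝ × ℝ => ∫ s in (0 : ℝ)..y.2, extend (kx k) s y.2 :=
      intervalIntegral.continuous_parametric_intervalIntegral_of_continuous
        (f := fun (y : ℝ × ℝ) s => extend (kx k) s y.2)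
        (hkx.comp (continuous_snd.prodMk (continuous_snd.comp continuous_fst))) continuous_snd
    exact ((hkc.comp (continuous_snd.prodMk continuous_snd)).add (c1.sub c2)).mul
      (hφ.comp continuous_snd)
  have hd : ∀ y z, HasDerivAt (fun y => h y z) (extend (kx k) y z * φ z) y := fun y z => by
    have hc : Continuous fun s => extend (kx k) s z :=
      hkx.comp (continuous_id.prodMk continuous_const)
    exact ((hc.integral_hasStrictDerivAt z y).hasDerivAt.const_add _).mul_const _
  have main := hasDerivAt_integral_variable hh
    (g := fun y z => extend (kx k) y z * φ z) (hkx.mul (hφ.comp continuous_snd)) hd 0 x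
  have hxx : h x x = k (x, x) * φ x := by
    simp only [h, intervalIntegral.integral_same, add_zero]
    rw [extend_of_mem k ⟨hx.1.le, le_rfl, hx.2.le⟩]
  rw [hxx] at main
  refine main.congr_of_eventuallyEq ?_
  filter_upwards [Ioo_mem_nhds hx.1 hx.2] with y hy
  refine intervalIntegral.integral_congr_ae (Eventually.of_forall fun z hz => ?_)
  rw [uIoc_of_le hy.1.le] at hz
  have hmem : ∀ s ∈ Icc z y, (s, z) ∈ triangle := fun s hs => ⟨hz.1.le, hs.1, hs.2.trans hy.2.le⟩
  have ftc : ∫ s in z..y, extend (kx k) s z = k (y, z) - k (z, z) := by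
    refine intervalIntegral.integral_eq_sub_of_hasDerivAt_of_le (f := fun s => k (s, z)) hz.2
      (hk.continuousOn.comp (f := fun s : ℝ => (s, z)) (by fun_prop) hmem) (fun s hs => ?_)
      ((hkx.comp (continuous_id.prodMk continuous_const)).intervalIntegrable _ _)
    rw [extend_of_mem _ (hmem s (Ioo_subset_Icc_self hs))]
    exact hasDerivAt_fst hk hz.1 hs.1 (hs.2.trans hy.2)
  simp only [h]
  rw [ftc, extend_of_mem k (hmem y ⟨hz.2, le_rfl⟩), extend_of_mem k (hmem z ⟨le_rfl, hz.2⟩)]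
  ring

theorem integral_kernel_mul_deriv (hk : ContDiffOn ℝ 1 k triangle) {φ φ' : ℝ → ℝ}
    (hφ : ∀ x, HasDerivAt φ (φ' x) x) (hφ' : Continuous φ') {x : ℝ} (hx : x ∈ Ioo (0 : ℝ) 1) :
    ∫ z in (0 : ℝ)..x, extend k x z * φ' z =
      k (x, x) * φ x - k (x, 0) * φ 0 - ∫ z in (0 : ℝ)..x, extend (kz k) x z * φ z := by
  have hmem : ∀ z ∈ Icc 0 x, (x, z) ∈ triangle := fun z hz => ⟨hz.1, hz.2, hx.2.le⟩
  have hslice : ∀ {k : ℝ × ℝ → ℝ}, ContinuousOn k triangle → Continuous (extend k x) :=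
    fun hk => (continuous_extend hk).comp (continuous_const.prodMk continuous_id)
  have hkz := hslice (contDiffOn_kz (m := 0) hk (by norm_num)).continuousOn
  have h := intervalIntegral.integral_mul_deriv_eq_deriv_mul_of_hasDerivAt
    (u := extend k x) (u' := extend (kz k) x) (v := φ) (v' := φ') (a := 0) (b := x)
    (hslice hk.continuousOn).continuousOn
    (continuous_iff_continuousAt.2 fun x => (hφ x).continuousAt).continuousOn
    (fun z hz => ?_) (fun z _ => hφ z) (hkz.intervalIntegrable _ _)
    (hφ'.intervalIntegrable _ _)
  · rw [h, extend_of_mem k (hmem x ⟨hx.1.le, le_rfl⟩), extend_of_mem k (hmem 0 ⟨le_rfl, hx.1.le⟩)]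
  · rw [min_eq_left hx.1.le, max_eq_right hx.1.le] at hz
    rw [extend_of_mem _ (hmem z (Ioo_subset_Icc_self hz))]
    refine (hasDerivAt_snd hk hz.1 hz.2 hx.2).congr_of_eventuallyEq ?_
    filter_upwards [Ioo_mem_nhds hz.1 hz.2] with s hs
    exact extend_of_mem _ (hmem s (Ioo_subset_Icc_self hs))

end Differentiable

namespace IsKernel

variable {a c₀ : ℝ} {k : ℝ × ℝ → ℝ}

/-- The diagonal condition integrated from the corner `(1, 1)`, where `k` vanishes. Its value `c₀ /
2` at the origin is the shift of the Robin coefficient. -/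
theorem diagonal_eq (hk : IsKernel a c₀ k) {x : ℝ} (hx : x ∈ Icc (0 : ℝ) 1) :
    k (x, x) = c₀ / 2 * (1 - x) := by
  have hd : ∀ y ∈ Icc (0 : ℝ) 1,
      HasDerivWithinAt (fun y => k (y, y) + c₀ / 2 * y) 0 (Icc 0 1) y := fun y hy => by
    refine ((hasDerivWithinAt_diag (hk.contDiffOn.of_le (by norm_num)) hy).add
      ((hasDerivAt_id y).const_mul (c₀ / 2)).hasDerivWithinAt).congr_deriv ?_
    rw [hk.diagonal y hy]; ring
  have hconst := constant_of_has_deriv_right_zero (fun y hy => (hd y hy).continuousWithinAt)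
    (fun y hy => (hd y (Ico_subset_Icc_self hy)).mono_of_mem_nhdsWithin
      (Icc_mem_nhdsGE_of_mem hy))
  have h1 := hconst 1 ⟨zero_le_one, le_rfl⟩
  have h2 := hconst x hx
  rw [hk.right_edge 1 ⟨zero_le_one, le_rfl⟩] at h1
  linarith

theorem abs_le_kernelMax (hk : IsKernel a c₀ k) {y : ℝ × ℝ} (hy : y ∈ triangle) :
    |k y| ≤ kernelMax k :=
  le_csSup (isCompact_triangle.image_of_continuousOn hk.contDiffOn.continuousOn.abs).bddAbove
    ⟨y, hy, rfl⟩

theorem kernelMax_nonneg (hk : IsKernel a c₀ k) : 0 ≤ kernelMax k :=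
  (abs_nonneg _).trans (hk.abs_le_kernelMax (y := (0, 0)) ⟨le_rfl, le_rfl, zero_le_one⟩)

theorem abs_extend_le (hk : IsKernel a c₀ k) (x z : ℝ) : |extend k x z| ≤ kernelMax k :=
  hk.abs_le_kernelMax (toTriangle_mem x z)

theorem continuous_extend (hk : IsKernel a c₀ k) : Continuous (Function.uncurry (extend k)) :=
  BacksteppingObserver.continuous_extend hk.contDiffOn.continuousOn

theorem continuous_extend_right (hk : IsKernel a c₀ k) (x : ℝ) : Continuous (extend k x) :=
  hk.continuous_extend.comp (continuous_const.prodMk continuous_id)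

end IsKernel

/-! ### The backstepping transformation -/

/-- The Volterra transformation `v ↦ v - ∫₀ˣ k(x, z) v(z) dz`. -/
def backstep (k : ℝ × ℝ → ℝ) (v : ℝ → ℝ → ℝ) (x t : ℝ) : ℝ :=
  v x t - ∫ z in (0 : ℝ)..x, extend k x z * v z t

/-- Gronwall by a weighted maximum: let `S` be the maximum of `|φ x| e^{-Mx}`, attained at `y`. The
integral bound gives `|K y| ≤ S e^{My} - S`, and `|φ y| = S e^{My}`, so `S ≤ W`. -/
theorem abs_le_of_volterra {K φ : ℝ → ℝ} {M W : ℝ} (hφ : ContinuousOn φ (Icc 0 1)) (hM : 0 ≤ M)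
    (h : ∀ x ∈ Icc (0 : ℝ) 1, |φ x - K x| ≤ W)
    (hK : ∀ x ∈ Icc (0 : ℝ) 1, |K x| ≤ ∫ z in (0 : ℝ)..x, M * |φ z|) :
    ∀ x ∈ Icc (0 : ℝ) 1, |φ x| ≤ Real.exp M * W := by
  have hW : 0 ≤ W := (abs_nonneg _).trans (h 0 ⟨le_rfl, zero_le_one⟩)
  obtain ⟨y, hy, hmax⟩ := isCompact_Icc.exists_isMaxOn (nonempty_Icc.2 zero_le_one)
    (hφ.abs.mul (by fun_prop : ContinuousOn (fun x => Real.exp (-(M * x))) (Icc (0 : ℝ) 1)))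
  set S := |φ y| * Real.exp (-(M * y)) with hS
  have hle : ∀ x ∈ Icc (0 : ℝ) 1, |φ x| ≤ S * Real.exp (M * x) := fun x hx => by
    have h1 : |φ x| * Real.exp (-(M * x)) ≤ S := hmax hx
    calc |φ x| = |φ x| * Real.exp (-(M * x)) * Real.exp (M * x) := by
          rw [mul_assoc, ← Real.exp_add]; simp
      _ ≤ _ := mul_le_mul_of_nonneg_right h1 (Real.exp_pos _).le
  have heq : |φ y| = S * Real.exp (M * y) := by
    rw [hS, mul_assoc, ← Real.exp_add]; simp
  have hint : ∫ z in (0 : ℝ)..y, M * (S * Real.exp (M * z)) = S * Real.exp (M * y) - S := by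
    rw [intervalIntegral.integral_eq_sub_of_hasDerivAt (f := fun z => S * Real.exp (M * z))]
    · simp
    · intro z _
      exact (((hasDerivAt_id z).const_mul M).exp.const_mul S).congr_deriv (by simp; ring)
    · exact (by fun_prop : Continuous fun z => M * (S * Real.exp (M * z))).intervalIntegrable _ _
  have hmono : ∫ z in (0 : ℝ)..y, M * |φ z| ≤ ∫ z in (0 : ℝ)..y, M * (S * Real.exp (M * z)) := by
    refine intervalIntegral.integral_mono_on hy.1 ?_ ?_ fun z hz =>
      mul_le_mul_of_nonneg_left (hle z ⟨hz.1, hz.2.trans hy.2⟩) hM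
    · refine ContinuousOn.intervalIntegrable ?_
      rw [uIcc_of_le hy.1]
      exact continuousOn_const.mul (hφ.abs.mono (Icc_subset_Icc_right hy.2))
    · exact (by fun_prop : Continuous fun z => M * (S * Real.exp (M * z))).intervalIntegrable _ _
  have hSW : S ≤ W := by
    have h1 : |φ y| ≤ W + |K y| := by
      have := abs_sub_abs_le_abs_sub (φ y) (K y)
      linarith [h y hy]
    linarith [hK y hy]
  intro x hx
  calc |φ x| ≤ S * Real.exp (M * x) := hle x hx
    _ ≤ W * Real.exp M := mul_le_mul hSW (Real.exp_le_exp.2 (mul_le_of_le_one_right hM hx.2))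
        (Real.exp_pos _).le hW
    _ = Real.exp M * W := mul_comm _ _

/-! ### Derivatives, boundary values and heat residual of the transformed function. -/

section Transform

variable {a c₀ : ℝ} {m : ℝ × ℝ → ℝ} {v vx vxx vt : ℝ → ℝ → ℝ}

theorem IsRegular.continuous_space (hv : IsRegular v vx vxx vt) (t : ℝ) :
    Continuous fun z => v z t :=
  hv.cont.comp (continuous_id.prodMk continuous_const)

theorem abs_le_of_abs_backstep_le (hm : IsKernel a c₀ m) (hv : IsRegular v vx vxx vt) {t W : ℝ}
    (h : ∀ x ∈ Icc (0 : ℝ) 1, |backstep m v x t| ≤ W) :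
    ∀ x ∈ Icc (0 : ℝ) 1, |v x t| ≤ Real.exp (kernelMax m) * W := by
  refine abs_le_of_volterra (hv.continuous_space t).continuousOn hm.kernelMax_nonneg h
    fun x hx => ?_
  have hc := hv.continuous_space t
  refine (intervalIntegral.abs_integral_le_integral_abs hx.1).trans
    (intervalIntegral.integral_mono_on hx.1 ?_ ?_ fun z _ => ?_)
  · exact ((hm.continuous_extend_right x).mul hc).abs.intervalIntegrable _ _
  · exact (continuous_const.mul hc.abs).intervalIntegrable _ _
  · rw [abs_mul]
    exact mul_le_mul_of_nonneg_right (hm.abs_extend_le x z) (abs_nonneg _)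

theorem abs_integral_extend_mul_le (hm : IsKernel a c₀ m) {φ : ℝ → ℝ} {B x : ℝ}
    (hφ : ∀ z ∈ Icc (0 : ℝ) 1, |φ z| ≤ B) (hx : x ∈ Icc (0 : ℝ) 1) :
    |∫ z in (0 : ℝ)..x, extend m x z * φ z| ≤ kernelMax m * B := by
  have hB : 0 ≤ B := (abs_nonneg _).trans (hφ 0 ⟨le_rfl, zero_le_one⟩)
  have h := intervalIntegral.norm_integral_le_of_norm_le_const (a := 0) (b := x)
    (f := fun z => extend m x z * φ z) (C := kernelMax m * B) fun z hz => ?_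
  · rw [Real.norm_eq_abs, sub_zero, abs_of_nonneg hx.1] at h
    exact h.trans (mul_le_of_le_one_right (mul_nonneg hm.kernelMax_nonneg hB) hx.2)
  · rw [uIoc_of_le hx.1] at hz
    rw [Real.norm_eq_abs, abs_mul]
    exact mul_le_mul (hm.abs_extend_le x z) (hφ z ⟨hz.1.le, hz.2.trans hx.2⟩) (abs_nonneg _)
      hm.kernelMax_nonneg

theorem isInteriorRegular_backstep (hm : IsKernel a c₀ m) (hv : IsRegular v vx vxx vt) (T : ℝ) :
    IsInteriorRegular T (backstep m v)
      (fun x t => vx x t - (m (x, x) * v x t + ∫ z in (0 : ℝ)..x, extend (kx m) x z * v z t))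
      (fun x t => vxx x t - (((kx m (x, x) + kz m (x, x)) * v x t + m (x, x) * vx x t) +
        (kx m (x, x) * v x t + ∫ z in (0 : ℝ)..x, extend (kx (kx m)) x z * v z t)))
      (backstep m vt) where
  cont := by
    refine Continuous.continuousOn ?_
    refine hv.cont.sub ?_
    exact intervalIntegral.continuous_parametric_intervalIntegral_of_continuous
      (f := fun (y : ℝ × ℝ) z => extend m y.1 z * v z y.2)
      ((hm.continuous_extend.comp ((continuous_fst.comp continuous_fst).prodMk continuous_snd)).mul
        (hv.cont.comp (continuous_snd.prodMk (continuous_snd.comp continuous_fst))))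
      continuous_fst
  deriv_x x hx t _ := (hv.deriv_x x t).sub
    (hasDerivAt_integral_kernel (hm.contDiffOn.of_le (by norm_num)) (hv.continuous_space t) hx)
  deriv_xx x hx t _ := by
    refine (hv.deriv_xx x t).sub (HasDerivAt.add ?_ (hasDerivAt_integral_kernel
      (contDiffOn_kx hm.contDiffOn (by norm_num)) (hv.continuous_space t) hx))
    exact ((hasDerivWithinAt_diag (hm.contDiffOn.of_le (by norm_num))
      (Ioo_subset_Icc_self hx)).hasDerivAt (Icc_mem_nhds hx.1 hx.2)).mul (hv.deriv_x x t)
  deriv_t x _ t _ := by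
    refine (hv.deriv_t x t).sub (hasDerivAt_integral_param
      (h := fun s z => extend m x z * v z s) (g := fun s z => extend m x z * vt z s) ?_ ?_
      (fun s z => (hv.deriv_t z s).const_mul _) 0 x t)
    · exact ((hm.continuous_extend_right x).comp continuous_snd).mul
        (hv.cont.comp continuous_swap)
    · exact ((hm.continuous_extend_right x).comp continuous_snd).mul
        (hv.cont_t.comp continuous_swap)

theorem hasDerivWithinAt_backstep_zero (hm : IsKernel a c₀ m) (hv : IsRegular v vx vxx vt)
    (t : ℝ) : HasDerivWithinAt (fun x => backstep m v x t) (vx 0 t - c₀ / 2 * v 0 t)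
      (Icc 0 1) 0 := by
  have h0 : extend m 0 0 = c₀ / 2 := by
    rw [extend_of_mem m ⟨le_rfl, le_rfl, zero_le_one⟩, hm.diagonal_eq ⟨le_rfl, zero_le_one⟩]
    ring
  rw [← h0]
  exact ((hv.deriv_x 0 t).sub (hasDerivAt_integral_endpoint
    (h := fun x z => extend m x z * v z t) (hm.continuous_extend.mul
      ((hv.continuous_space t).comp continuous_snd)) 0)).hasDerivWithinAt

theorem backstep_one (hm : IsKernel a c₀ m) (t : ℝ) : backstep m v 1 t = v 1 t := by
  have : ∫ z in (0 : ℝ)..1, extend m 1 z * v z t = ∫ z in (0 : ℝ)..1, (0 : ℝ) := by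
    refine intervalIntegral.integral_congr fun z hz => ?_
    rw [uIcc_of_le zero_le_one] at hz
    rw [extend_of_mem m ⟨hz.1, hz.2, le_rfl⟩, hm.right_edge z hz, zero_mul]
  rw [backstep, this]
  simp

/-- The commutator of the backstepping transformation with the heat operator. -/
theorem backstep_heat (hm : IsKernel a a m) (hv : IsRegular v vx vxx vt) {x : ℝ}
    (hx : x ∈ Ioo (0 : ℝ) 1) (t : ℝ) :
    backstep m vt x t - (vxx x t - (((kx m (x, x) + kz m (x, x)) * v x t + m (x, x) * vx x t) +
        (kx m (x, x) * v x t + ∫ z in (0 : ℝ)..x, extend (kx (kx m)) x z * v z t)))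
      + a * backstep m v x t =
    backstep m (fun z t => vt z t - vxx z t) x t + m (x, 0) * vx 0 t - kz m (x, 0) * v 0 t := by
  have hm1 : ContDiffOn ℝ 1 m triangle := hm.contDiffOn.of_le (by norm_num)
  have hmz : ContDiffOn ℝ 1 (kz m) triangle := contDiffOn_kz hm.contDiffOn (by norm_num)
  have hmx : ContDiffOn ℝ 1 (kx m) triangle := contDiffOn_kx hm.contDiffOn (by norm_num)
  have cv := hv.continuous_space t
  have cxx : Continuous fun z => vxx z t := hv.cont_xx.comp (continuous_id.prodMk continuous_const)
  have ct : Continuous fun z => vt z t := hv.cont_t.comp (continuous_id.prodMk continuous_const)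
  have hslice : ∀ {k : ℝ × ℝ → ℝ}, ContinuousOn k triangle → Continuous (extend k x) :=
    fun hk => (continuous_extend hk).comp (continuous_const.prodMk continuous_id)
  have cm := hm.continuous_extend_right x
  have cmxx := hslice (contDiffOn_kx (m := 0) hmx (by norm_num)).continuousOn
  have cmzz := hslice (contDiffOn_kz (m := 0) hmz (by norm_num)).continuousOn
  have hint : ∀ {f g : ℝ → ℝ}, Continuous f → Continuous g →
      IntervalIntegrable (fun z => f z * g z) volume 0 x :=
    fun hf hg => (hf.mul hg).intervalIntegrable _ _
  -- Two integrations by parts move `∂_zz` from `v` to `m`. The kernel equation then cancels `a ∫ m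
  -- v`, the diagonal condition cancels `a v`, and only the traces at `z = 0` survive.
  have p1 := integral_kernel_mul_deriv hm1 (fun z => hv.deriv_xx z t) cxx hx
  have p2 := integral_kernel_mul_deriv hmz (fun z => hv.deriv_x z t)
    (hv.cont_x.comp (continuous_id.prodMk continuous_const)) hx
  have p3 : ∫ z in (0 : ℝ)..x, extend m x z * (vt z t - vxx z t) =
      (∫ z in (0 : ℝ)..x, extend m x z * vt z t) - ∫ z in (0 : ℝ)..x, extend m x z * vxx z t := by
    rw [← intervalIntegral.integral_sub (hint cm ct) (hint cm cxx)]
    exact intervalIntegral.integral_congr fun z _ => mul_sub _ _ _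
  have p4 : (∫ z in (0 : ℝ)..x, extend (kx (kx m)) x z * v z t) -
      (∫ z in (0 : ℝ)..x, extend (kz (kz m)) x z * v z t) =
      a * ∫ z in (0 : ℝ)..x, extend m x z * v z t := by
    rw [← intervalIntegral.integral_sub (hint cmxx cv) (hint cmzz cv),
      ← intervalIntegral.integral_const_mul]
    refine intervalIntegral.integral_congr fun z _ => ?_
    have := hm.pde _ (toTriangle_mem x z)
    simp only [extend]
    linear_combination v z t * this
  have p5 := hm.diagonal x (Ioo_subset_Icc_self hx)
  simp only [backstep, p3]
  linear_combination -p1 + p2 + p4 + 2 * v x t * p5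

end Transform

/-! ### Estimates for the error system -/

section Design

variable {q c₀ p₀ : ℝ} {lam p : ℝ → ℝ} {m : ℝ × ℝ → ℝ}

theorem IsDesign.bddBelow (hD : IsDesign q lam c₀ m p₀ p) :
    BddBelow ((fun t => c₀ - lam t) '' Ici (0 : ℝ)) := by
  obtain ⟨B, hB⟩ := hD.lam_bdd
  refine ⟨c₀ - B, ?_⟩
  rintro _ ⟨t, ht, rfl⟩
  have := hB ⟨t, ht, rfl⟩
  simp only
  linarith

theorem IsDesign.cInf_le (hD : IsDesign q lam c₀ m p₀ p) {t : ℝ} (ht : 0 ≤ t) :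
    cInf lam c₀ ≤ c₀ - lam t :=
  csInf_le hD.bddBelow ⟨t, ht, rfl⟩

theorem IsDesign.cInf_pos (hD : IsDesign q lam c₀ m p₀ p) : 0 < cInf lam c₀ := by
  refine (sub_pos.2 hD.lam_lt).trans_le (le_csInf (nonempty_Ici.image _) ?_)
  rintro _ ⟨t, ht, rfl⟩
  have := le_csSup hD.lam_bdd ⟨t, ht, rfl⟩
  simp only
  linarith

theorem IsDesign.abs_le_gainMax (hD : IsDesign q lam c₀ m p₀ p) {x : ℝ}
    (hx : x ∈ Icc (0 : ℝ) 1) : |p x| ≤ gainMax p :=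
  le_csSup (isCompact_Icc.image_of_continuousOn hD.p_cont.abs).bddAbove ⟨x, hx, rfl⟩

theorem IsDesign.gainMax_nonneg (hD : IsDesign q lam c₀ m p₀ p) : 0 ≤ gainMax p :=
  (abs_nonneg _).trans (hD.abs_le_gainMax (x := 0) ⟨le_rfl, zero_le_one⟩)

/-- The target system: under the transformation the error system becomes a damped heat
equation. -/
theorem IsDesign.backstep_target (hD : IsDesign q lam c₀ m p₀ p) {v vx vxx vt : ℝ → ℝ → ℝ}
    (hv : IsRegular v vx vxx vt) {x : ℝ} (hx : x ∈ Ioo (0 : ℝ) 1) (t : ℝ) :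
    backstep m (fun z t => vt z t - vxx z t) x t + m (x, 0) * vx 0 t - kz m (x, 0) * v 0 t =
      lam t * backstep m v x t +
      backstep m (fun z t => vt z t - vxx z t - lam t * v z t + p z * v 0 t) x t +
      m (x, 0) * (vx 0 t - (q + p₀) * v 0 t) := by
  have cm := hD.kernel.continuous_extend_right x
  have cv := hv.continuous_space t
  have cr : Continuous fun z => vt z t - vxx z t :=
    (hv.cont_t.sub hv.cont_xx).comp (continuous_id.prodMk continuous_const)
  have hint : ∀ {g : ℝ → ℝ}, Continuous g →
      IntervalIntegrable (fun z => extend m x z * g z) volume 0 x :=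
    fun hg => (cm.mul hg).intervalIntegrable _ _
  have ip : IntervalIntegrable (fun z => extend m x z * p z) volume 0 x := by
    refine ContinuousOn.intervalIntegrable ?_
    rw [uIcc_of_le hx.1.le]
    exact cm.continuousOn.mul (hD.p_cont.mono (Icc_subset_Icc_right hx.2.le))
  have h1 : ∫ z in (0 : ℝ)..x, extend m x z * (vt z t - vxx z t - lam t * v z t + p z * v 0 t) =
      (∫ z in (0 : ℝ)..x, extend m x z * (vt z t - vxx z t)) -
      lam t * (∫ z in (0 : ℝ)..x, extend m x z * v z t) +
      v 0 t * ∫ z in (0 : ℝ)..x, extend m x z * p z := by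
    rw [← intervalIntegral.integral_const_mul, ← intervalIntegral.integral_const_mul,
      ← intervalIntegral.integral_sub (hint cr) ((hint cv).const_mul _),
      ← intervalIntegral.integral_add ((hint cr).sub ((hint cv).const_mul _)) (ip.const_mul _)]
    exact intervalIntegral.integral_congr fun z _ => by ring
  have h2 : ∫ z in (0 : ℝ)..x, m (x, z) * p z = ∫ z in (0 : ℝ)..x, extend m x z * p z := by
    refine intervalIntegral.integral_congr fun z hz => ?_
    rw [uIcc_of_le hx.1.le] at hz
    rw [extend_of_mem m ⟨hz.1, hz.2, hx.2.le⟩]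
  -- The gain equation says that the transform of `p` is `(q + p₀) m (x, 0) - m_z (x, 0)`, which is
  -- what cancels every remaining multiple of `v 0 t`.
  have h3 := hD.p_eq x (Ioo_subset_Icc_self hx)
  rw [h2] at h3
  simp only [backstep, h1]
  linear_combination -v 0 t * h3

/-- `R` and `E` bound the source and flux defects of `v` in the undisturbed system. The flux defect
enters twice: as the Robin datum of the target system, and multiplied by `m (x, 0)` in its source,
whence `kernelMax m * E`. Forward transformation costs `1 + kernelMax m`, inversion `exp (kernelMax
m)`. -/
theorem IsDesign.regular_estimate (hD : IsDesign q lam c₀ m p₀ p) {v vx vxx vt : ℝ → ℝ → ℝ}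
    (hv : IsRegular v vx vxx vt) {T σ R E D A : ℝ} (hT : 0 < T) (hσ : σ ≤ cInf lam c₀)
    (hR : ∀ x ∈ Icc (0 : ℝ) 1, ∀ t ∈ Ioc 0 T,
      |vt x t - vxx x t - lam t * v x t + p x * v 0 t| ≤ R)
    (hE : ∀ t ∈ Ioc 0 T, |vx 0 t - (q + p₀) * v 0 t| ≤ E)
    (hright : ∀ t ∈ Ioc 0 T, |v 1 t| ≤ D) (hinit : ∀ x ∈ Icc (0 : ℝ) 1, |v x 0| ≤ A) :
    ∀ x ∈ Icc (0 : ℝ) 1, |v x T| ≤ Real.exp (kernelMax m) *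
      (Real.exp (-σ * T) * ((1 + kernelMax m) * A) +
        ((1 + kernelMax m) * R + kernelMax m * E) / cInf lam c₀ + D + E) := by
  have hTI : T ∈ Ioc 0 T := ⟨hT, le_rfl⟩
  have h01 : (0 : ℝ) ∈ Icc (0 : ℝ) 1 := ⟨le_rfl, zero_le_one⟩
  have hM := hD.kernel.kernelMax_nonneg
  have hR0 : 0 ≤ R := (abs_nonneg _).trans (hR 0 h01 T hTI)
  have hE0 : 0 ≤ E := (abs_nonneg _).trans (hE T hTI)
  have hD0 : 0 ≤ D := (abs_nonneg _).trans (hright T hTI)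
  have hA0 : 0 ≤ A := (abs_nonneg _).trans (hinit 0 h01)
  have hback : ∀ {w : ℝ → ℝ → ℝ} {B t x : ℝ}, (∀ z ∈ Icc (0 : ℝ) 1, |w z t| ≤ B) →
      x ∈ Icc (0 : ℝ) 1 → |backstep m w x t| ≤ (1 + kernelMax m) * B := fun {w B t x} hB hx => by
    have h1 := abs_integral_extend_mul_le hD.kernel hB hx
    calc |backstep m w x t| ≤ |w x t| + _ := abs_sub _ _
      _ ≤ B + kernelMax m * B := add_le_add (hB x hx) h1
      _ = _ := by ring
  refine abs_le_of_abs_backstep_le hD.kernel hv fun x hx => ?_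
  refine (isInteriorRegular_backstep hD.kernel hv T).abs_le_of_damped
    (a := fun t => c₀ - lam t) (ĝ := fun t => vx 0 t - (q + p₀) * v 0 t)
    (κ := q + p₀ - c₀ / 2) hσ hD.cInf_pos (by linarith [hD.p₀_gt]) (by positivity) (by positivity)
    hE0 hD0 (fun t ht => hD.cInf_le ht.1.le) (fun x hx t ht => ?_) (fun t _ => ?_) hE
    (fun t ht => ?_) (fun x hx => hback hinit hx) x hx T ⟨hT.le, le_rfl⟩
  · have h1 := backstep_heat hD.kernel hv hx t
    rw [hD.backstep_target hv hx t] at h1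
    have hxI := Ioo_subset_Icc_self hx
    have h2 := hback (w := fun z t => vt z t - vxx z t - lam t * v z t + p z * v 0 t)
      (fun z hz => hR z hz t ht) hxI
    have h3 : |m (x, 0) * (vx 0 t - (q + p₀) * v 0 t)| ≤ kernelMax m * E := by
      rw [abs_mul]
      exact mul_le_mul (hD.kernel.abs_le_kernelMax ⟨le_rfl, hx.1.le, hx.2.le⟩) (hE t ht)
        (abs_nonneg _) hM
    refine le_trans (le_of_eq ?_) ((abs_add_le _ _).trans (add_le_add h2 h3))
    congr 1
    linear_combination h1
  · refine (hasDerivWithinAt_backstep_zero hD.kernel hv t).congr_deriv ?_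
    simp [backstep]
    ring
  · rw [backstep_one hD.kernel]
    exact hright t ht

end Design

theorem le_of_forall_pos_le_add_mul {a b K : ℝ} (h : ∀ ε > 0, a ≤ b + ε * K) : a ≤ b := by
  refine le_of_forall_pos_le_add fun ε hε => ?_
  have hK : 0 < |K| + 1 := by positivity
  refine (h (ε / (|K| + 1)) (by positivity)).trans ?_
  have : ε / (|K| + 1) * K ≤ ε / (|K| + 1) * (|K| + 1) :=
    mul_le_mul_of_nonneg_left (by linarith [le_abs_self K]) (by positivity)
  rw [div_mul_cancel₀ _ hK.ne'] at this
  linarith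

/-! ### Transfer of the estimate to classical solutions by approximation. -/

section Solution

variable {q c₀ p₀ : ℝ} {lam p : ℝ → ℝ} {m : ℝ × ℝ → ℝ} {f : ℝ → ℝ → ℝ} {dm d₀ d₁ u₀ : ℝ → ℝ}
  {u : ℝ → ℝ → ℝ}

theorem IsErrorSolution.isInteriorRegular (hu : IsErrorSolution q lam p₀ p f dm d₀ d₁ u₀ u)
    (T : ℝ) : IsInteriorRegular T u (dX u) (dX (dX u)) (dT u) where
  cont := hu.cont.mono (prod_mono_right Icc_subset_Ici_self)
  deriv_x x hx t ht := (hu.c21.diff_x x hx t ht.1).hasDerivAt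
  deriv_xx x hx t ht := (hu.c21.diff_xx x hx t ht.1).hasDerivAt
  deriv_t x hx t ht := (hu.c21.diff_t x hx t ht.1).hasDerivAt

theorem IsErrorSolution.cont_time (hu : IsErrorSolution q lam p₀ p f dm d₀ d₁ u₀ u) {x : ℝ}
    (hx : x ∈ Icc (0 : ℝ) 1) : ContinuousOn (fun t => u x t) (Ici 0) :=
  hu.cont.comp (f := fun t : ℝ => (x, t)) (by fun_prop) fun _ ht => ⟨hx, ht⟩

theorem IsErrorSolution.cont_space (hu : IsErrorSolution q lam p₀ p f dm d₀ d₁ u₀ u) {t : ℝ}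
    (ht : 0 ≤ t) : ContinuousOn (fun x => u x t) (Icc 0 1) :=
  hu.cont.comp (f := fun x : ℝ => (x, t)) (by fun_prop) fun _ hx => ⟨hx, ht⟩

theorem IsErrorSolution.estimate (hD : IsDesign q lam c₀ m p₀ p) (hd : IsDisturbance f dm d₀ d₁)
    (hu : IsErrorSolution q lam p₀ p f dm d₀ d₁ u₀ u) {T σ U Sf Sm S₀ S₁ : ℝ} (hT : 0 < T)
    (hσ : σ ≤ cInf lam c₀) (hU : ∀ x ∈ Icc (0 : ℝ) 1, |u x 0| ≤ U)
    (hf : ∀ x ∈ Icc (0 : ℝ) 1, ∀ t ∈ Icc 0 T, |f x t| ≤ Sf)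
    (hm : ∀ t ∈ Icc 0 T, |dm t| ≤ Sm) (h₀ : ∀ t ∈ Icc 0 T, |d₀ t| ≤ S₀)
    (h₁ : ∀ t ∈ Icc 0 T, |d₁ t| ≤ S₁) :
    ∀ x ∈ Icc (0 : ℝ) 1, |u x T| ≤ Real.exp (kernelMax m) *
      (Real.exp (-σ * T) * ((1 + kernelMax m) * U) +
        ((1 + kernelMax m) * (Sf + gainMax p * Sm) + kernelMax m * (S₀ + |p₀| * Sm)) /
          cInf lam c₀ + S₁ + (S₀ + |p₀| * Sm)) := by
  have h01 : (0 : ℝ) ∈ Icc (0 : ℝ) 1 := ⟨le_rfl, zero_le_one⟩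
  have h11 : (1 : ℝ) ∈ Icc (0 : ℝ) 1 := ⟨zero_le_one, le_rfl⟩
  have hP := hD.gainMax_nonneg
  have hc := hD.cInf_pos
  -- `L` may depend on `T`: it occurs only in terms multiplied by `ε`.
  obtain ⟨L, hL⟩ := isCompact_Icc.exists_bound_of_continuousOn
    (hD.lam_cont.mono (Icc_subset_Ici_self : Icc 0 T ⊆ Ici 0))
  have hL0 : 0 ≤ L := (norm_nonneg _).trans (hL 0 ⟨le_rfl, hT.le⟩)
  -- With `u` frozen in `F` and `G`, the solution satisfies `u_t - u_xx = F` with flux `G`; the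
  -- coupling through `u 0 t` becomes given data.
  let F : ℝ → ℝ → ℝ := fun x t => lam t * u x t + (f x t - p x * dm t) - p x * u 0 t
  let G : ℝ → ℝ := fun t => (d₀ t + p₀ * dm t) + (q + p₀) * u 0 t
  have hmaps : MapsTo Prod.snd (Icc (0 : ℝ) 1 ×ˢ Ici (0 : ℝ)) (Ici (0 : ℝ)) := fun y hy => hy.2
  have hmapp : MapsTo Prod.fst (Icc (0 : ℝ) 1 ×ˢ Ici (0 : ℝ)) (Icc (0 : ℝ) 1) := fun y hy => hy.1
  have hu0 := hu.cont_time h01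
  have hFc : ContinuousOn (Function.uncurry F) (Icc 0 1 ×ˢ Ici 0) := by
    have c1 := hD.p_cont.comp continuousOn_fst hmapp
    exact (((hD.lam_cont.comp continuousOn_snd hmaps).mul hu.cont).add
      (hd.f_cont.sub (c1.mul (hd.dm_cont.comp continuousOn_snd hmaps)))).sub
      (c1.mul (hu0.comp continuousOn_snd hmaps))
  have hGc : ContinuousOn G (Ici 0) :=
    (hd.d₀_cont.add (continuousOn_const.mul hd.dm_cont)).add (continuousOn_const.mul hu0)
  intro x hx
  set N := 3 + 2 * T with hN
  have hN0 : 0 < N := by positivity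
  -- `K` collects the coefficients of `ε`: data mismatch, the errors `ε * N` of `v` weighted by
  -- `lam`, `p` and `q + p₀`, and the final return from `v` to `u`.
  refine le_of_forall_pos_le_add_mul (K := Real.exp (kernelMax m) *
      (Real.exp (-σ * T) * (1 + kernelMax m) +
        ((1 + kernelMax m) * (1 + L * N + gainMax p * N) +
          kernelMax m * (1 + |q + p₀| * N)) / cInf lam c₀ + 1 + (1 + |q + p₀| * N)) + N)
    fun ε hε => ?_
  -- The Dirichlet datum is `u 1`, not `d₁`, since the boundary condition is imposed only for `t >
  -- 0`. The corner compatibility at `t = 0` is then `rfl`.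
  obtain ⟨v, vx, vxx, vt, hv, hvp, hvi, hvl, hvr⟩ := exists_regular_near (T := T) hT.le hε
    (hFc.mono (prod_mono_right Icc_subset_Ici_self)) (hu.cont_space le_rfl)
    (hGc.mono Icc_subset_Ici_self) ((hu.cont_time h11).mono Icc_subset_Ici_self) rfl
  have hdiff : ∀ x ∈ Icc (0 : ℝ) 1, ∀ t ∈ Icc 0 T, |u x t - v x t| ≤ ε * N := by
    refine ((hu.isInteriorRegular T).sub (hv.isInteriorRegular T)).abs_le_of_heat hε ?_ ?_ ?_ ?_
    · intro x hx t ht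
      have h1 := hvp x (Ioo_subset_Icc_self hx) t (Ioc_subset_Icc_self ht)
      rw [abs_sub_comm] at h1
      refine le_trans (le_of_eq ?_) h1
      congr 1
      have := hu.pde x hx t ht.1
      simp only [F]
      linear_combination this
    · intro t ht
      refine ⟨G t - vx 0 t, ?_, (hu.left_bc t ht.1).sub (hv.deriv_x 0 t).hasDerivWithinAt⟩
      rw [abs_sub_comm]
      exact hvl t (Ioc_subset_Icc_self ht)
    · intro t ht
      rw [abs_sub_comm]
      exact hvr t (Ioc_subset_Icc_self ht)
    · intro x hx
      rw [abs_sub_comm]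
      exact hvi x hx
  have key := hD.regular_estimate hv (T := T) (σ := σ)
    (R := (Sf + gainMax p * Sm) + ε * (1 + L * N + gainMax p * N))
    (E := (S₀ + |p₀| * Sm) + ε * (1 + |q + p₀| * N)) (D := S₁ + ε) (A := U + ε) hT hσ
    ?_ ?_ ?_ ?_ x hx
  · have h1 := hdiff x hx T ⟨hT.le, le_rfl⟩
    have h2 : |u x T| ≤ |v x T| + ε * N := by
      have := abs_sub_abs_le_abs_sub (u x T) (v x T)
      linarith
    refine h2.trans ((add_le_add_left key _).trans (le_of_eq ?_))
    field_simp
    ring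
  · intro x hx t ht
    have ht' := Ioc_subset_Icc_self ht
    have e1 := hvp x hx t ht'
    have e2 : |lam t * (u x t - v x t)| ≤ L * (ε * N) := by
      rw [abs_mul]
      exact mul_le_mul (hL t ht') (hdiff x hx t ht') (abs_nonneg _) hL0
    have e3 : |p x * dm t| ≤ gainMax p * Sm := by
      rw [abs_mul]
      exact mul_le_mul (hD.abs_le_gainMax hx) (hm t ht') (abs_nonneg _) hP
    have e4 : |p x * (u 0 t - v 0 t)| ≤ gainMax p * (ε * N) := by
      rw [abs_mul]
      exact mul_le_mul (hD.abs_le_gainMax hx) (hdiff 0 h01 t ht') (abs_nonneg _) hP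
    have e5 := hf x hx t ht'
    simp only [F] at e1
    rw [abs_le] at *
    constructor <;> linarith [e1.1, e1.2, e2.1, e2.2, e3.1, e3.2, e4.1, e4.2, e5.1, e5.2]
  · intro t ht
    have ht' := Ioc_subset_Icc_self ht
    have e1 := hvl t ht'
    have e2 : |(q + p₀) * (u 0 t - v 0 t)| ≤ |q + p₀| * (ε * N) := by
      rw [abs_mul]
      exact mul_le_mul_of_nonneg_left (hdiff 0 h01 t ht') (abs_nonneg _)
    have e3 : |p₀ * dm t| ≤ |p₀| * Sm := by
      rw [abs_mul]
      exact mul_le_mul_of_nonneg_left (hm t ht') (abs_nonneg _)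
    have e4 := h₀ t ht'
    simp only [G] at e1
    rw [abs_le] at *
    constructor <;> linarith [e1.1, e1.2, e2.1, e2.2, e3.1, e3.2, e4.1, e4.2]
  · intro t ht
    have ht' := Ioc_subset_Icc_self ht
    have e1 := hvr t ht'
    have e2 := h₁ t ht'
    rw [hu.right_bc t ht.1] at e1
    rw [abs_le] at *
    constructor <;> linarith [e1.1, e1.2, e2.1, e2.2]
  · intro x hx
    have e1 := hvi x hx
    have e2 := hU x hx
    rw [abs_le] at *
    constructor <;> linarith [e1.1, e1.2, e2.1, e2.2]

end Solution

/-! ### Essential suprema of continuous functions -/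

/-- A violation at `t` persists on a nonempty open subset of `(a, b)`, which has positive measure.
Endpoints are covered because they lie in the closure. -/
theorem le_of_ae_le_of_continuousOn {a b : ℝ} (hab : a < b) {g : ℝ → ℝ≥0∞} {N : ℝ≥0∞}
    (hg : ContinuousOn g (Icc a b)) (h : ∀ᵐ t ∂volume.restrict (Ioo a b), g t ≤ N) :
    ∀ t ∈ Icc a b, g t ≤ N := by
  intro t ht
  by_contra! hlt
  have h1 : {s | N < g s} ∈ 𝓝[Ioo a b] t :=
    nhdsWithin_mono t Ioo_subset_Icc_self ((hg t ht).eventually (lt_mem_nhds hlt))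
  obtain ⟨V, hV, htV, hsub⟩ := mem_nhdsWithin.1 h1
  have hne : (V ∩ Ioo a b).Nonempty := by
    have : t ∈ closure (Ioo a b) := by rwa [closure_Ioo hab.ne]
    exact mem_closure_iff.1 this V hV htV
  have hpos := (hV.inter isOpen_Ioo).measure_pos volume hne
  rw [ae_restrict_iff' measurableSet_Ioo, ae_iff] at h
  refine hpos.ne' (measure_mono_null ?_ h)
  intro s hs hs'
  exact absurd (hs' hs.2) (not_le.2 (hsub hs))

theorem enorm_le_linftyNorm {a b : ℝ} (hab : a < b) {g : ℝ → ℝ} (hg : ContinuousOn g (Icc a b)) :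
    ∀ t ∈ Icc a b, ‖g t‖ₑ ≤ linftyNorm g a b := by
  refine le_of_ae_le_of_continuousOn hab hg.enorm ?_
  rw [linftyNorm, eLpNorm_exponent_top]
  exact ae_le_eLpNormEssSup

theorem linftyNorm_le {a b C : ℝ} {g : ℝ → ℝ} (hg : ∀ t ∈ Ioo a b, |g t| ≤ C) :
    linftyNorm g a b ≤ ENNReal.ofReal C := by
  rw [linftyNorm, eLpNorm_exponent_top]
  refine eLpNormEssSup_le_of_ae_bound ?_
  rw [ae_restrict_iff' measurableSet_Ioo]
  exact Eventually.of_forall hg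

theorem linftyNorm_ne_top {a b : ℝ} {g : ℝ → ℝ} (hg : ContinuousOn g (Icc a b)) :
    linftyNorm g a b ≠ ⊤ := by
  obtain ⟨C, hC⟩ := isCompact_Icc.exists_bound_of_continuousOn hg
  exact ((linftyNorm_le fun t ht => hC t (Ioo_subset_Icc_self ht)).trans_lt
    ENNReal.ofReal_lt_top).ne

theorem abs_le_toReal_of_enorm_le {r : ℝ} {N : ℝ≥0∞} (hN : N ≠ ⊤) (h : ‖r‖ₑ ≤ N) :
    |r| ≤ N.toReal := by
  have := ENNReal.toReal_mono hN h
  simpa using this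

theorem abs_le_linftyNorm {a b : ℝ} (hab : a < b) {g : ℝ → ℝ} (hg : ContinuousOn g (Icc a b)) :
    ∀ t ∈ Icc a b, |g t| ≤ (linftyNorm g a b).toReal := fun t ht =>
  abs_le_toReal_of_enorm_le (linftyNorm_ne_top hg) (enorm_le_linftyNorm hab hg t ht)

theorem linftyLinftyNorm_ne_top {T : ℝ} {f : ℝ → ℝ → ℝ}
    (hf : ContinuousOn (Function.uncurry f) (Icc 0 1 ×ˢ Icc 0 T)) :
    linftyLinftyNorm f T ≠ ⊤ := by
  obtain ⟨C, hC⟩ := (isCompact_Icc.prod isCompact_Icc).exists_bound_of_continuousOn hf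
  refine (lt_of_le_of_lt ?_ (ENNReal.ofReal_lt_top (r := C))).ne
  refine essSup_le_of_ae_le _ ?_
  refine (ae_restrict_iff' measurableSet_Ioo).2 (Eventually.of_forall fun t ht => ?_)
  exact linftyNorm_le fun x hx => hC (x, t) ⟨Ioo_subset_Icc_self hx, Ioo_subset_Icc_self ht⟩

theorem abs_le_linftyLinftyNorm {T : ℝ} (hT : 0 < T) {f : ℝ → ℝ → ℝ}
    (hf : ContinuousOn (Function.uncurry f) (Icc 0 1 ×ˢ Icc 0 T)) :
    ∀ x ∈ Icc (0 : ℝ) 1, ∀ t ∈ Icc 0 T, |f x t| ≤ (linftyLinftyNorm f T).toReal := by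
  intro x hx t ht
  refine abs_le_toReal_of_enorm_le (linftyLinftyNorm_ne_top hf) ?_
  -- With `x` fixed, the inner norm dominates `|f x s|` for every `s` in `(0, T)`, the outer one
  -- holds for almost every `s`, and continuity in time gives all `t`.
  refine le_of_ae_le_of_continuousOn (g := fun t => ‖f x t‖ₑ) hT ?_ ?_ t ht
  · exact (hf.comp (f := fun t : ℝ => (x, t)) (by fun_prop) fun t ht => ⟨hx, ht⟩).enorm
  · have hae : ∀ᵐ t ∂volume.restrict (Ioo 0 T),
        linftyNorm (fun x => f x t) 0 1 ≤ linftyLinftyNorm f T := ENNReal.ae_le_essSup _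
    filter_upwards [hae, ae_restrict_mem measurableSet_Ioo] with s hs hsT
    refine (enorm_le_linftyNorm (g := fun x => f x s) one_pos ?_ x hx).trans hs
    exact hf.comp (f := fun x : ℝ => (x, s)) (by fun_prop)
      fun x hx => ⟨hx, Ioo_subset_Icc_self hsT⟩

/-! ### Input-to-state stability -/

/-- The gain of the estimation error in terms of `c = cInf`, `p₀`, `P = gainMax` and
`M = kernelMax`. -/
def errorGain (c p₀ P M : ℝ) : ℝ :=
  Real.exp M * ((1 + |M|) * (1 + (1 + |P| + |p₀|) / |c|) + 1 + |p₀|)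

/-- The absolute values in `errorGain` serve this purpose: positivity at all real arguments,
including `c = 0`, where division returns `0`. -/
theorem errorGain_pos (c p₀ P M : ℝ) : 0 < errorGain c p₀ P M := by
  unfold errorGain
  positivity

theorem le_errorGain_mul {c p₀ P M e U Sf Sm S₀ S₁ : ℝ} (hc : 0 < c) (hP : 0 ≤ P) (hM : 0 ≤ M)
    (he : 0 ≤ e) (hU : 0 ≤ U) (hSf : 0 ≤ Sf) (hSm : 0 ≤ Sm) (hS₀ : 0 ≤ S₀) (hS₁ : 0 ≤ S₁) :
    Real.exp M * (e * ((1 + M) * U) +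
        ((1 + M) * (Sf + P * Sm) + M * (S₀ + |p₀| * Sm)) / c + S₁ + (S₀ + |p₀| * Sm)) ≤
      errorGain c p₀ P M * (e * U + Sm + S₀ + S₁ + Sf) := by
  rw [errorGain, abs_of_pos hc, abs_of_nonneg hP, abs_of_nonneg hM, mul_assoc]
  refine mul_le_mul_of_nonneg_left ?_ (Real.exp_pos _).le
  have hQ : 0 ≤ |p₀| := abs_nonneg _
  have heU : 0 ≤ e * U := mul_nonneg he hU
  have h1 : ((1 + M) * (Sf + P * Sm) + M * (S₀ + |p₀| * Sm)) / c ≤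
      ((1 + M) * ((1 + P + |p₀|) * (e * U + Sm + S₀ + S₁ + Sf))) / c := by
    refine div_le_div_of_nonneg_right ?_ hc.le
    have : M * (S₀ + |p₀| * Sm) ≤ (1 + M) * (S₀ + |p₀| * Sm) :=
      mul_le_mul_of_nonneg_right (by linarith) (by positivity)
    have h2 : Sf + P * Sm + (S₀ + |p₀| * Sm) ≤ (1 + P + |p₀|) * (e * U + Sm + S₀ + S₁ + Sf) := by
      -- Exactly the right side of `h2` minus its left side; `h5` plays the same role for the final
      -- inequality.
      have : 0 ≤ (1 + P + |p₀|) * (e * U + S₁) + (P + |p₀|) * (S₀ + Sf) + Sm := by positivity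
      linarith
    have h3 := mul_le_mul_of_nonneg_left h2 (by linarith : 0 ≤ 1 + M)
    linarith
  have h4 : (1 + M) * ((1 + P + |p₀|) / c) * (e * U + Sm + S₀ + S₁ + Sf) =
      ((1 + M) * ((1 + P + |p₀|) * (e * U + Sm + S₀ + S₁ + Sf))) / c := by ring
  have h5 : 0 ≤ (1 + M) * (Sm + S₀ + S₁ + Sf) + (e * U + Sm + Sf) +
      |p₀| * (e * U + S₀ + S₁ + Sf) := by positivity
  linarith

/-- The finiteness clauses are what makes the `toNNReal` norms in `IsISS` faithful. -/
theorem IsErrorSolution.linftyNorm_le {q c₀ p₀ : ℝ} {lam p : ℝ → ℝ} {m : ℝ × ℝ → ℝ}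
    {f : ℝ → ℝ → ℝ} {dm d₀ d₁ u₀ : ℝ → ℝ} {u : ℝ → ℝ → ℝ} (hD : IsDesign q lam c₀ m p₀ p)
    (hd : IsDisturbance f dm d₀ d₁) (hu : IsErrorSolution q lam p₀ p f dm d₀ d₁ u₀ u) {T σ : ℝ}
    (hT : 0 < T) (hσ : σ ≤ cInf lam c₀) :
    linftyNorm u₀ 0 1 ≠ ⊤ ∧ linftyNorm dm 0 T ≠ ⊤ ∧ linftyNorm d₀ 0 T ≠ ⊤ ∧
      linftyNorm d₁ 0 T ≠ ⊤ ∧ linftyLinftyNorm f T ≠ ⊤ ∧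
    linftyNorm (fun x => u x T) 0 1 ≤
      ENNReal.ofReal (errorGain (cInf lam c₀) p₀ (gainMax p) (kernelMax m)) *
        (ENNReal.ofReal (Real.exp (-σ * T)) * linftyNorm u₀ 0 1 + linftyNorm dm 0 T
          + linftyNorm d₀ 0 T + linftyNorm d₁ 0 T + linftyLinftyNorm f T) := by
  have hu₀ : linftyNorm u₀ 0 1 = linftyNorm (fun x => u x 0) 0 1 := by
    refine eLpNorm_congr_ae ?_
    filter_upwards [ae_restrict_mem measurableSet_Ioo] with x hx using (hu.init x hx).symm
  have cu := hu.cont_space le_rfl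
  have cm := hd.dm_cont.mono (Icc_subset_Ici_self : Icc 0 T ⊆ Ici 0)
  have c0 := hd.d₀_cont.mono (Icc_subset_Ici_self : Icc 0 T ⊆ Ici 0)
  have c1 := hd.d₁_cont.mono (Icc_subset_Ici_self : Icc 0 T ⊆ Ici 0)
  have cf : ContinuousOn (Function.uncurry f) (Icc 0 1 ×ˢ Icc 0 T) :=
    hd.f_cont.mono (prod_mono_right Icc_subset_Ici_self)
  rw [hu₀]
  have fu := linftyNorm_ne_top cu
  have fm := linftyNorm_ne_top cm
  have f0 := linftyNorm_ne_top c0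
  have f1 := linftyNorm_ne_top c1
  have ff := linftyLinftyNorm_ne_top cf
  refine ⟨fu, fm, f0, f1, ff, ?_⟩
  have h := hu.estimate hD hd hT hσ (abs_le_linftyNorm one_pos cu) (abs_le_linftyLinftyNorm hT cf)
    (abs_le_linftyNorm hT cm) (abs_le_linftyNorm hT c0) (abs_le_linftyNorm hT c1)
  refine (BacksteppingObserver.linftyNorm_le fun x hx => (h x (Ioo_subset_Icc_self hx)).trans
    (le_errorGain_mul hD.cInf_pos hD.gainMax_nonneg hD.kernel.kernelMax_nonneg
      (Real.exp_pos _).le ENNReal.toReal_nonneg ENNReal.toReal_nonneg ENNReal.toReal_nonneg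
      ENNReal.toReal_nonneg ENNReal.toReal_nonneg)).trans (le_of_eq ?_)
  rw [ENNReal.ofReal_mul (errorGain_pos _ _ _ _).le, ENNReal.ofReal_add (by positivity)
    (by positivity), ENNReal.ofReal_add (by positivity) (by positivity), ENNReal.ofReal_add
    (by positivity) (by positivity), ENNReal.ofReal_add (by positivity) (by positivity),
    ENNReal.ofReal_mul (Real.exp_pos _).le, ENNReal.ofReal_toReal fu, ENNReal.ofReal_toReal fm,
    ENNReal.ofReal_toReal f0, ENNReal.ofReal_toReal f1, ENNReal.ofReal_toReal ff]

theorem classK_const_mul {C : ℝ≥0} (hC : 0 < C) : ClassK fun s => C * s :=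
  ⟨mul_zero C, by fun_prop, fun _ _ h => mul_lt_mul_of_pos_left h hC⟩

theorem classKL_exp {C : ℝ≥0} {σ : ℝ} (hC : 0 < C) (hσ : 0 < σ) :
    ClassKL fun s t => C * (Real.toNNReal (Real.exp (-σ * t)) * s) := by
  have hpos : ∀ t : ℝ≥0, 0 < Real.toNNReal (Real.exp (-σ * t)) := fun t =>
    Real.toNNReal_pos.2 (Real.exp_pos _)
  refine ⟨?_, fun t => ⟨by simp, by fun_prop, fun a b h => ?_⟩, fun s hs => ⟨?_, ?_, ?_⟩⟩
  · unfold Function.uncurry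
    fun_prop
  · exact mul_lt_mul_of_pos_left (mul_lt_mul_of_pos_left h (hpos t)) hC
  · fun_prop
  · intro a b hab
    refine mul_lt_mul_of_pos_left (mul_lt_mul_of_pos_right ?_ hs) hC
    rw [Real.toNNReal_lt_toNNReal_iff (Real.exp_pos _), Real.exp_lt_exp]
    have : (a : ℝ) < b := hab
    nlinarith
  · have h1 : Tendsto (fun t : ℝ≥0 => Real.exp (-σ * t)) atTop (𝓝 0) := by
      refine Real.tendsto_exp_atBot.comp ?_
      exact (NNReal.tendsto_coe_atTop.2 tendsto_id).const_mul_atTop_of_neg (by linarith)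
    have h2 := (tendsto_real_toNNReal h1).mul_const s |>.const_mul C
    simpa using h2

theorem IsDesign.isISS {q c₀ p₀ : ℝ} {lam p : ℝ → ℝ} {m : ℝ × ℝ → ℝ}
    (hD : IsDesign q lam c₀ m p₀ p) : IsISS q lam p₀ p := by
  set C := Real.toNNReal (errorGain (cInf lam c₀) p₀ (gainMax p) (kernelMax m)) with hC
  have hCpos : 0 < C := Real.toNNReal_pos.2 (errorGain_pos _ _ _ _)
  refine ⟨_, _, _, _, _, classKL_exp hCpos hD.cInf_pos, classK_const_mul hCpos,
    classK_const_mul hCpos, classK_const_mul hCpos, classK_const_mul hCpos, ?_⟩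
  intro f dm d₀ d₁ u₀ u hd hu T hT
  -- The barrier allows the full rate `σ = cInf lam c₀`, so `β` decays at that rate and all gains
  -- are linear.
  obtain ⟨fu, fm, f0, f1, ff, h⟩ := hu.linftyNorm_le hD hd hT le_rfl
  refine h.trans (le_of_eq ?_)
  push_cast
  rw [ENNReal.coe_toNNReal fu, ENNReal.coe_toNNReal fm, ENNReal.coe_toNNReal f0,
    ENNReal.coe_toNNReal f1, ENNReal.coe_toNNReal ff, Real.coe_toNNReal T hT.le,
    ENNReal.ofReal, ENNReal.ofReal, ← hC]
  ring

end BacksteppingObserver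

end

theorem theorem2 :
    -- `c₃` is a function of the seven listed quantities only
    ∃ c₃ : ℝ → ℝ → ℝ → ℝ → ℝ → ℝ → ℝ → ℝ,
      (∀ a₁ a₂ a₃ a₄ a₅ a₆ a₇ : ℝ, 0 < c₃ a₁ a₂ a₃ a₄ a₅ a₆ a₇) ∧
      ∀ (q : ℝ) (lam : ℝ → ℝ) (c₀ : ℝ) (m n : ℝ × ℝ → ℝ) (p₀ : ℝ) (p : ℝ → ℝ),
        BacksteppingObserver.IsDesign q lam c₀ m p₀ p →
        BacksteppingObserver.IsKernel (-c₀) c₀ n →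
        BacksteppingObserver.IsISS q lam p₀ p ∧
        ∀ σ ∈ Set.Ioo 0 (BacksteppingObserver.cInf lam c₀),
          ∀ (f : ℝ → ℝ → ℝ) (dm d₀ d₁ u₀ : ℝ → ℝ) (u : ℝ → ℝ → ℝ),
            BacksteppingObserver.IsDisturbance f dm d₀ d₁ →
            BacksteppingObserver.IsErrorSolution q lam p₀ p f dm d₀ d₁ u₀ u →
            ∀ T : ℝ, 0 < T →
              BacksteppingObserver.linftyNorm (fun x => u x T) 0 1 ≤
                ENNReal.ofReal
                  (c₃ (BacksteppingObserver.cInf lam c₀) σ p₀ q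
                    (BacksteppingObserver.gainMax p) (BacksteppingObserver.kernelMax m)
                    (BacksteppingObserver.kernelMax n)) *
                (ENNReal.ofReal (Real.exp (-σ * T)) * BacksteppingObserver.linftyNorm u₀ 0 1
                  + BacksteppingObserver.linftyNorm dm 0 T
                  + BacksteppingObserver.linftyNorm d₀ 0 T
                  + BacksteppingObserver.linftyNorm d₁ 0 T
                  + BacksteppingObserver.linftyLinftyNorm f T) := by
  -- The bound is uniform in the Robin coefficient and in the rate, and inversion costs `exp M` by
  -- Gronwall; hence only `c`, `p₀`, `P` and `M` appear in the value.
  refine ⟨fun c _ p₀ _ P M _ => BacksteppingObserver.errorGain c p₀ P M,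
    fun _ _ _ _ _ _ _ => BacksteppingObserver.errorGain_pos _ _ _ _, ?_⟩
  intro q lam c₀ m n p₀ p hD _
  refine ⟨hD.isISS, fun σ hσ f dm d₀ d₁ u₀ u hd hu T hT => ?_⟩
  exact (hu.linftyNorm_le hD hd hT hσ.2.le).2.2.2.2.2
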